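/- A computer is a partial recursive function $C\colon\{0,1\}^*\to\{0,1\}^*$ whose domain is prefix-free. Let $U$ be an optimal computer, i.e. a computer such that for every computer $C$ there is a constant $d$ such that whenever $C(p)$ is defined, there is $p'$ with $U(p')=C(p)$ and $|p'|\le|p|+d$. Put $H(s)=\min\{|p| : U(p)=s\}$. Let $q_1,q_2,q_3,\dots$ be any (not necessarily recursive) enumeration without repetition of the domain of $U$, and for $n\ge 1$ and real $T>0$ let $$Z_n(T)=\sum_{i=1}^n 2^{-|q_i|/T},\qquad E_n(T)=\frac1{Z_n(T)}\sum_{i=1}^n |q_i|\,2^{-|q_i|/T},\qquad S_n(T)=\frac1T E_n(T)+\log_2 Z_n(T).$$ The statistical mechanical entropy is $S(T)=\lim_{n\to\infty}S_n(T)$. A real $x$ is computable if there is a total recursive $f\colon\mathbb N^+\to\mathbb Q$ with $|x-f(n)|<1/n$ for all $n\ge1$, and left-computable if there is a total recursive $g\colon\mathbb N^+\to\mathbb Q$ with $g(n)\le x$ for all $n\ge1$ and $g(n)\to x$. Let $x_n$ denote the first $n$ bits of the base-two expansion, with infinitely many zeros, of the fractional part $x-\lfloor x\rfloor$. For real $D\ge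 0$, $x$ is Chaitin $D$-random if $\lim_{n\to\infty}(H(x_n)-Dn)=\infty$, and $D$-compressible if $H(x_n)\le Dn+o(n)$. Theorem. Let $T\in\mathbb R$. (i) If $0<T<1$ and $T$ is computable, then $S_n(T)$ converges as $n\to\infty$, and its limit $S(T)$ is a left-computable real number which is Chaitin $T$-random and $T$-compressible. (ii) If $T\ge1$, then $S(T)$ diverges to $\infty$, i.e. $\lim_{n\to\infty}S_n(T)=\infty$. -/

import Mathlib

open Filter Topology

/-! ### Prefix-free computers and program-size complexity

Finite binary strings are `List Bool`, the empty string being `[]`. -/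

/-- A computer: a partial recursive function on finite binary strings with prefix-free domain. -/
structure IsComputer (C : List Bool →. List Bool) : Prop where
  partrec : Partrec C
  prefixFree : ∀ p ∈ C.Dom, ∀ p' ∈ C.Dom, p <+: p' → p = p'

/-- An optimal computer: a computer simulating every computer `C` with a constant overhead `sim`
in program length. -/
def IsOptimal (U : List Bool →. List Bool) : Prop :=
  IsComputer U ∧ ∀ C : List Bool →. List Bool, IsComputer C →
    ∃ sim : ℕ, ∀ p s : List Bool, s ∈ C p → ∃ p' : List Bool, s ∈ U p' ∧ p'.length ≤ p.length + sim

/-- The program-size complexity of `s` with respect to `C`: the least length of a `p` with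
`C p = s`. It is used for optimal computers only, for which such a `p` exists
(see `IsOptimal.exists_program`). -/
noncomputable def complexity (C : List Bool →. List Bool) (s : List Bool) : ℕ :=
  sInf {l : ℕ | ∃ p : List Bool, s ∈ C p ∧ p.length = l}

/-- Every string has a program for an optimal computer. -/
theorem IsOptimal.exists_program {U : List Bool →. List Bool} (hU : IsOptimal U) (s : List Bool) :
    ∃ p : List Bool, s ∈ U p := by
  have hC : IsComputer (fun p : List Bool => ((if p = [] then some s else none : Option (List Bool)) :
      Part (List Bool))) := by
    constructor
    · exact Computable.ofOption (Primrec.to_comp (Primrec.ite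
        (Primrec.eq.comp Primrec.id (Primrec.const [])) (Primrec.const _) (Primrec.const _)))
    · intro p hp p' hp' _
      have h : ∀ r : List Bool, ((if r = [] then some s else none : Option (List Bool)) :
          Part (List Bool)).Dom → r = [] := by
        intro r hr
        by_contra hne
        simp [hne] at hr
      rw [h p hp, h p' hp']
  obtain ⟨sim, h⟩ := hU.2 _ hC
  obtain ⟨p', hp', -⟩ := h [] s (by simp)
  exact ⟨p', hp'⟩

/-! ### Computable and left-computable real numbers -/

/-- A total recursive function with rational values, i.e. one that computes an integer numerator
(given as a difference of natural numbers) and a positive denominator. -/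
def IsRecursiveRat (f : ℕ → ℚ) : Prop :=
  ∃ a b c : ℕ → ℕ, Computable a ∧ Computable b ∧ Computable c ∧
    ∀ n, f n = ((a n : ℚ) - b n) / (c n + 1)

/-- Computable real numbers. -/
def IsComputableReal (x : ℝ) : Prop :=
  ∃ f : ℕ → ℚ, IsRecursiveRat f ∧ ∀ n : ℕ, 1 ≤ n → |x - f n| < 1 / n

/-- Right-computable real numbers. -/
def IsRightComputable (x : ℝ) : Prop :=
  ∃ g : ℕ → ℚ, IsRecursiveRat g ∧ (∀ n : ℕ, 1 ≤ n → x ≤ g n) ∧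
    Tendsto (fun n => (g n : ℝ)) atTop (𝓝 x)

/-- Left-computable real numbers. -/
def IsLeftComputable (x : ℝ) : Prop := IsRightComputable (-x)

/-! ### Randomness and compressibility -/

/-- The first `n` bits of the infinite binary string `α`. -/
def bitPrefix (α : ℕ → Bool) (n : ℕ) : List Bool := (List.range n).map α

/-- The infinite binary string of a real number `x`: the binary expansion of the fractional part
of `x` with infinitely many zeros. `Real.digits` computes the `i`-th digit after the point as
`⌊y * 2 ^ (i + 1)⌋` modulo `2`, which for dyadic `y` gives the expansion ending in zeros. -/
noncomputable def binaryExpansion (x : ℝ) : ℕ → Bool :=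
  fun i => decide (Real.digits (Int.fract x) 2 i = 1)

/-- Chaitin `D`-randomness of `α` with respect to the complexity of `U`: `H(α_n) - D n → ∞`. -/
def IsChaitinRandom (U : List Bool →. List Bool) (D : ℝ) (α : ℕ → Bool) : Prop :=
  Tendsto (fun n : ℕ => (complexity U (bitPrefix α n) : ℝ) - D * n) atTop atTop

/-- `D`-compressibility of `α` with respect to the complexity of `U`: `H(α_n) ≤ D n + o(n)`. -/
def IsCompressible (U : List Bool →. List Bool) (D : ℝ) (α : ℕ → Bool) : Prop :=
  ∃ e : ℕ → ℝ, Tendsto (fun n : ℕ => e n / n) atTop (𝓝 0) ∧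
    ∀ n : ℕ, 1 ≤ n → (complexity U (bitPrefix α n) : ℝ) ≤ D * n + e n

/-! ### Thermodynamic quantities

Here `q 0, q 1, q 2, …` enumerates the programs, so that the `n`-th approximations run over the
first `n` programs `q 0, …, q (n - 1)`. -/

/-- The `n`-th approximation `Z_n(T)` to the partition function. -/
noncomputable def partitionFn (q : ℕ → List Bool) (n : ℕ) (T : ℝ) : ℝ :=
  ∑ i ∈ Finset.range n, (2 : ℝ) ^ (-((q i).length : ℝ) / T)

/-- The `n`-th approximation `E_n(T)` to the energy. -/
noncomputable def energyFn (q : ℕ → List Bool) (n : ℕ) (T : ℝ) : ℝ :=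
  1 / partitionFn q n T *
    ∑ i ∈ Finset.range n, ((q i).length : ℝ) * (2 : ℝ) ^ (-((q i).length : ℝ) / T)

/-- The `n`-th approximation `S_n(T)` to the statistical mechanical entropy. -/
noncomputable def entropyFn (q : ℕ → List Bool) (n : ℕ) (T : ℝ) : ℝ :=
  1 / T * energyFn q n T + Real.logb 2 (partitionFn q n T)

/-- `q` enumerates the domain of `U` without repetition. The enumeration need not be recursive. -/
def IsEnumeration (q : ℕ → List Bool) (U : List Bool →. List Bool) : Prop :=
  Function.Injective q ∧ Set.range q = U.Dom

/-! Write `l i` for the program lengths, `β = 2^(-1/T)`, `Z = ∑ β^(l i)` and `A = ∑ l i * β^(l i)`,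
so that the entropy of a finite set of programs is `A / (T * Z) + log₂ Z`.

Let `T < 1`. Then `β < 1/2`, and Kraft's inequality makes `A` and `Z` converge. A program longer
than twice the mean energy raises the entropy when added, by at least a constant times `l * β^l`
(`finEntropy_insert`). Only finitely many programs are shorter than a given length, so beyond some
finite set `F₀` the entropy increases to its limit `S`. The defect `S - e` of such a set lies above
a constant times each single missing term `l * β^l`, and below a constant times the sum of all
missing terms (`exists_finEntropy_limit`). Since `T` is computable, the entropies of a recursive
sequence of finite sets exhausting the domain are computable, which gives left-computability.

Randomness: `n` bits of `S` lead to a stage with defect `O(2^(-n))`. Each missing program then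
satisfies `l ≥ T * n + T * log₂ l - O(1)`, and a string longer than every output seen so far is
produced only by missing programs. The factor `l` in `l * β^l` provides the logarithm, and so the
divergence of `H(S_n) - T * n`.

Compressibility: for rational `K / M > T`, the first `K * j` bits of `Ω = ∑ 2^(-l i)` lead to a
stage whose missing programs have total weight at most `2^(-K * j)`. This forces the energy tail,
and so the defect, down to `O(2^(-M * j))` (`exists_tail_bound`). Hence about `(K / M) * n` bits
determine `n` bits of `S` up to boundedly many candidates.

For `T ≥ 1` everything rests on the divergence of `∑ l i * 2^(-l i)` (`IsEnumeration.not_summable`).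
-/

/-! ### Closure properties of computable functions -/

namespace Computable

variable {α : Type*} [Primcodable α] {f g : α → ℕ}

theorem natAdd (hf : Computable f) (hg : Computable g) : Computable fun a => f a + g a :=
  Primrec.nat_add.to_comp.comp hf hg

theorem natSub (hf : Computable f) (hg : Computable g) : Computable fun a => f a - g a :=
  Primrec.nat_sub.to_comp.comp hf hg

theorem natMul (hf : Computable f) (hg : Computable g) : Computable fun a => f a * g a :=
  Primrec.nat_mul.to_comp.comp hf hg

theorem natDiv (hf : Computable f) (hg : Computable g) : Computable fun a => f a / g a :=
  Primrec.nat_div.to_comp.comp hf hg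

theorem natPow (hf : Computable f) (hg : Computable g) : Computable fun a => f a ^ g a :=
  (Primrec₂.unpaired'.1 Nat.Primrec.pow).to_comp.comp hf hg

theorem decideLE (hf : Computable f) (hg : Computable g) :
    Computable fun a => decide (f a ≤ g a) :=
  (Primrec.nat_le.decide).to_comp.comp hf hg

theorem decideLT (hf : Computable f) (hg : Computable g) :
    Computable fun a => decide (f a < g a) :=
  (Primrec.nat_lt.decide).to_comp.comp hf hg

theorem decideEq {β : Type*} [Primcodable β] [DecidableEq β] {f g : α → β}
    (hf : Computable f) (hg : Computable g) :
    Computable fun a => decide (f a = g a) :=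
  (Primrec.eq.decide).to_comp.comp hf hg

theorem boolAnd {p q : α → Bool} (hp : Computable p) (hq : Computable q) :
    Computable fun a => p a && q a :=
  Primrec.and.to_comp.comp hp hq

theorem sumRange {F : α → ℕ → ℕ} (hf : Computable f)
    (hF : Computable fun p : α × ℕ => F p.1 p.2) :
    Computable fun a => ∑ i ∈ Finset.range (f a), F a i := by
  have h : Computable₂ fun (a : α) (p : ℕ × ℕ) => p.2 + F a p.1 :=
    natAdd (snd.comp snd) (hF.comp (pair fst (fst.comp snd)))
  refine (nat_rec hf (const 0) h).of_eq fun a => ?_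
  induction f a with
  | zero => simp
  | succ n ih => rw [Finset.sum_range_succ, ← ih]

/-- Unbounded search. -/
theorem exists_search {p : α → ℕ → Bool} (hp : Computable fun x : α × ℕ => p x.1 x.2)
    (h : ∀ a, ∃ n, p a n = true) : ∃ F : α → ℕ, Computable F ∧ ∀ a, p a (F a) = true := by
  have hr : Partrec fun a => Nat.rfind fun n => (p a n : Part Bool) :=
    Partrec.rfind (Computable.partrec hp)
  choose F hF using fun a => show ∃ m, m ∈ Nat.rfind fun n => (p a n : Part Bool) by
    obtain ⟨n, hn⟩ := h a
    obtain ⟨m, hm, -⟩ := Nat.rfind_min' hn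
    exact ⟨m, hm⟩
  refine ⟨F, Partrec.of_eq_tot hr hF, fun a => ?_⟩
  simpa using Nat.rfind_spec (hF a)

end Computable

/-! ### Computable rational-valued functions -/

/-- The triple `(a, b, c)` represents the rational number `(a - b) / (c + 1)`. -/
def ratVal (r : ℕ × ℕ × ℕ) : ℚ := ((r.1 : ℚ) - r.2.1) / (r.2.2 + 1)

/-- Computable functions with rational values. -/
def IsCompRat {α : Type*} [Primcodable α] (f : α → ℚ) : Prop :=
  ∃ r : α → ℕ × ℕ × ℕ, Computable r ∧ ∀ a, f a = ratVal (r a)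

namespace IsCompRat

open Computable

variable {α β : Type*} [Primcodable α] [Primcodable β] {f g : α → ℚ}

theorem mk {a b c : α → ℕ} (ha : Computable a) (hb : Computable b) (hc : Computable c)
    (h : ∀ x, f x = ((a x : ℚ) - b x) / (c x + 1)) : IsCompRat f :=
  ⟨fun x => (a x, b x, c x), ha.pair (hb.pair hc), h⟩

theorem exists_nat (hf : IsCompRat f) : ∃ a b c : α → ℕ, Computable a ∧ Computable b ∧
    Computable c ∧ ∀ x, f x = ((a x : ℚ) - b x) / (c x + 1) := by
  obtain ⟨r, hr, h⟩ := hf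
  exact ⟨_, _, _, fst.comp hr, fst.comp (snd.comp hr), snd.comp (snd.comp hr), h⟩

theorem comp {f : α → ℚ} (hf : IsCompRat f) {k : β → α} (hk : Computable k) :
    IsCompRat fun b => f (k b) := by
  obtain ⟨r, hr, h⟩ := hf
  exact ⟨_, hr.comp hk, fun b => h (k b)⟩

theorem isRecursiveRat {f : ℕ → ℚ} (hf : IsCompRat f) : IsRecursiveRat f := hf.exists_nat

theorem of_isRecursiveRat {f : ℕ → ℚ} (hf : IsRecursiveRat f) : IsCompRat f := by
  obtain ⟨a, b, c, ha, hb, hc, h⟩ := hf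
  exact mk ha hb hc h

theorem natCast {k : α → ℕ} (hk : Computable k) : IsCompRat fun a => (k a : ℚ) :=
  mk hk (const 0) (const 0) (by simp)

theorem const (x : ℚ) : IsCompRat fun _ : α => x := by
  refine mk (Computable.const x.num.toNat) (Computable.const (-x.num).toNat)
    (Computable.const (x.den - 1)) fun _ => ?_
  have h1 : ((x.num.toNat : ℤ) : ℚ) - (((-x.num).toNat : ℤ) : ℚ) = (x.num : ℚ) := by
    rw [← Int.cast_sub, Int.toNat_sub_toNat_neg]
  have h2 : ((x.den - 1 : ℕ) : ℚ) + 1 = x.den := by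
    exact_mod_cast Nat.sub_add_cancel x.pos
  rw [h2]
  push_cast at h1
  rw [h1, Rat.num_div_den]

theorem neg (hf : IsCompRat f) : IsCompRat fun a => -f a := by
  obtain ⟨a, b, c, ha, hb, hc, h⟩ := hf.exists_nat
  refine mk hb ha hc fun x => ?_
  rw [h]; ring

/-- Addition of represented rational numbers. -/
def repAdd (r s : ℕ × ℕ × ℕ) : ℕ × ℕ × ℕ :=
  (r.1 * (s.2.2 + 1) + s.1 * (r.2.2 + 1), r.2.1 * (s.2.2 + 1) + s.2.1 * (r.2.2 + 1),
    -- `ratVal` divides by the third component plus one, and this is `(c + 1) * (c' + 1) - 1`.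
    r.2.2 * s.2.2 + r.2.2 + s.2.2)

/-- Multiplication of represented rational numbers. -/
def repMul (r s : ℕ × ℕ × ℕ) : ℕ × ℕ × ℕ :=
  (r.1 * s.1 + r.2.1 * s.2.1, r.1 * s.2.1 + r.2.1 * s.1, r.2.2 * s.2.2 + r.2.2 + s.2.2)

theorem ratVal_repAdd (r s) : ratVal (repAdd r s) = ratVal r + ratVal s := by
  have h1 : (r.2.2 : ℚ) + 1 ≠ 0 := by positivity
  have h2 : (s.2.2 : ℚ) + 1 ≠ 0 := by positivity
  simp only [ratVal, repAdd]
  push_cast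
  rw [div_add_div _ _ h1 h2]
  congr 1 <;> ring

theorem ratVal_repMul (r s) : ratVal (repMul r s) = ratVal r * ratVal s := by
  simp only [ratVal, repMul]
  push_cast
  rw [div_mul_div_comm]
  congr 1 <;> ring

theorem computable_repAdd {r s : α → ℕ × ℕ × ℕ} (hr : Computable r) (hs : Computable s) :
    Computable fun a => repAdd (r a) (s a) := by
  have r1 := fst.comp hr
  have r2 := fst.comp (snd.comp hr)
  have r3 := snd.comp (snd.comp hr)
  have s1 := fst.comp hs
  have s2 := fst.comp (snd.comp hs)
  have s3 := snd.comp (snd.comp hs)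
  have k : Computable fun _ : α => 1 := Computable.const 1
  exact (((r1.natMul (s3.natAdd k)).natAdd (s1.natMul (r3.natAdd k))).pair
    (((r2.natMul (s3.natAdd k)).natAdd (s2.natMul (r3.natAdd k))).pair
      (((r3.natMul s3).natAdd r3).natAdd s3)))

theorem computable_repMul {r s : α → ℕ × ℕ × ℕ} (hr : Computable r) (hs : Computable s) :
    Computable fun a => repMul (r a) (s a) := by
  have r1 := fst.comp hr
  have r2 := fst.comp (snd.comp hr)
  have r3 := snd.comp (snd.comp hr)
  have s1 := fst.comp hs
  have s2 := fst.comp (snd.comp hs)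
  have s3 := snd.comp (snd.comp hs)
  exact (((r1.natMul s1).natAdd (r2.natMul s2)).pair
    (((r1.natMul s2).natAdd (r2.natMul s1)).pair (((r3.natMul s3).natAdd r3).natAdd s3)))

theorem add (hf : IsCompRat f) (hg : IsCompRat g) : IsCompRat fun a => f a + g a := by
  obtain ⟨r, hr, h⟩ := hf
  obtain ⟨s, hs, h'⟩ := hg
  exact ⟨_, computable_repAdd hr hs, fun a => by simp only [ratVal_repAdd, h, h']⟩

theorem sub (hf : IsCompRat f) (hg : IsCompRat g) : IsCompRat fun a => f a - g a := by
  simpa only [sub_eq_add_neg] using hf.add hg.neg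

theorem mul (hf : IsCompRat f) (hg : IsCompRat g) : IsCompRat fun a => f a * g a := by
  obtain ⟨r, hr, h⟩ := hf
  obtain ⟨s, hs, h'⟩ := hg
  exact ⟨_, computable_repMul hr hs, fun a => by simp only [ratVal_repMul, h, h']⟩

theorem pow (hf : IsCompRat f) {k : α → ℕ} (hk : Computable k) :
    IsCompRat fun a => f a ^ k a := by
  obtain ⟨r, hr, h⟩ := hf
  have hstep : Computable₂ fun (a : α) (p : ℕ × ℕ × ℕ × ℕ) => repMul p.2 (r a) :=
    computable_repMul (snd.comp snd) (hr.comp fst)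
  refine ⟨_, nat_rec hk (Computable.const (1, 0, 0)) hstep, fun a => ?_⟩
  dsimp only
  induction k a with
  | zero => simp [ratVal]
  | succ n ih => rw [pow_succ, ih, h a, ← ratVal_repMul]

theorem sumRange {F : α → ℕ → ℚ} (hF : IsCompRat fun p : α × ℕ => F p.1 p.2)
    {k : α → ℕ} (hk : Computable k) : IsCompRat fun a => ∑ i ∈ Finset.range (k a), F a i := by
  obtain ⟨r, hr, h⟩ := hF
  have hstep : Computable₂ fun (a : α) (p : ℕ × ℕ × ℕ × ℕ) => repAdd p.2 (r (a, p.1)) :=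
    computable_repAdd (snd.comp snd) (hr.comp (fst.pair (fst.comp snd)))
  refine ⟨_, nat_rec hk (Computable.const (0, 0, 0)) hstep, fun a => ?_⟩
  dsimp only
  induction k a with
  | zero => simp [ratVal]
  | succ n ih => rw [Finset.sum_range_succ, ih, show F a n = ratVal (r (a, n)) from h (a, n), ← ratVal_repAdd]

theorem cond {p : α → Bool} (hp : Computable p) (hf : IsCompRat f) (hg : IsCompRat g) :
    IsCompRat fun a => if p a = true then f a else g a := by
  obtain ⟨r, hr, h⟩ := hf
  obtain ⟨s, hs, h'⟩ := hg
  refine ⟨_, Computable.cond hp hr hs, fun a => ?_⟩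
  cases hpa : p a <;> simp [h, h', hpa]

theorem decide_lt (hf : IsCompRat f) (hg : IsCompRat g) :
    Computable fun a => decide (f a < g a) := by
  obtain ⟨a, b, c, ha, hb, hc, h⟩ := (hg.sub hf).exists_nat
  refine (hb.decideLT ha).of_eq fun x => ?_
  rw [decide_eq_decide, ← sub_pos (a := g x), h, div_pos_iff_of_pos_right (by positivity), sub_pos,
    Nat.cast_lt]

theorem max (hf : IsCompRat f) (hg : IsCompRat g) : IsCompRat fun a => max (f a) (g a) := by
  obtain ⟨r, hr, h⟩ := cond (hf.decide_lt hg) hg hf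
  refine ⟨r, hr, fun a => ?_⟩
  rw [← h a]
  dsimp only
  split_ifs with h1
  · exact max_eq_right (of_decide_eq_true h1).le
  · exact max_eq_left (not_lt.1 fun h2 => h1 (decide_eq_true h2))

/-- A nonnegative computable rational-valued function is a quotient of computable functions. -/
theorem exists_nat_of_nonneg (hf : IsCompRat f) (h0 : ∀ a, 0 ≤ f a) :
    ∃ m d : α → ℕ, Computable m ∧ Computable d ∧ ∀ x, f x = (m x : ℚ) / (d x + 1) := by
  obtain ⟨a, b, c, ha, hb, hc, h⟩ := hf.exists_nat
  refine ⟨_, c, ha.natSub hb, hc, fun x => ?_⟩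
  have h1 := h0 x
  rw [h, le_div_iff₀ (by positivity), zero_mul, sub_nonneg, Nat.cast_le] at h1
  rw [h, Nat.cast_sub h1]

theorem inv (hf : IsCompRat f) (h0 : ∀ a, 0 < f a) : IsCompRat fun a => (f a)⁻¹ := by
  obtain ⟨m, d, hm, hd, h⟩ := hf.exists_nat_of_nonneg fun a => (h0 a).le
  refine mk (hd.natAdd (Computable.const 1)) (Computable.const 0)
    (hm.natSub (Computable.const 1)) fun x => ?_
  have h1 := h0 x
  rw [h, lt_div_iff₀ (by positivity), zero_mul, Nat.cast_pos] at h1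
  rw [h, inv_div, Nat.cast_sub (by omega)]
  simp

end IsCompRat

/-! ### Computable real-valued functions -/

/-- A real-valued function is computable if there are computable rational lower and upper bounds
that converge to it. -/
def IsCompReal {α : Type*} [Primcodable α] (x : α → ℝ) : Prop :=
  ∃ lo hi : α → ℕ → ℚ, (IsCompRat fun p : α × ℕ => lo p.1 p.2) ∧
    (IsCompRat fun p : α × ℕ => hi p.1 p.2) ∧
    (∀ a n, (lo a n : ℝ) ≤ x a) ∧ (∀ a n, x a ≤ hi a n) ∧
    (∀ a, Tendsto (fun n => (lo a n : ℝ)) atTop (𝓝 (x a))) ∧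
    ∀ a, Tendsto (fun n => (hi a n : ℝ)) atTop (𝓝 (x a))

namespace IsCompReal

open Computable

variable {α β : Type*} [Primcodable α] [Primcodable β] {x y : α → ℝ}

theorem ofRat {f : α → ℚ} (hf : IsCompRat f) : IsCompReal fun a => (f a : ℝ) :=
  ⟨fun a _ => f a, fun a _ => f a, hf.comp fst, hf.comp fst, fun _ _ => le_rfl, fun _ _ => le_rfl,
    fun _ => tendsto_const_nhds, fun _ => tendsto_const_nhds⟩

theorem natCast {k : α → ℕ} (hk : Computable k) : IsCompReal fun a => (k a : ℝ) := by
  simpa using ofRat (IsCompRat.natCast hk)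

theorem comp (hx : IsCompReal x) {k : β → α} (hk : Computable k) :
    IsCompReal fun b => x (k b) := by
  obtain ⟨lo, hi, hlo, hhi, h1, h2, h3, h4⟩ := hx
  exact ⟨fun b n => lo (k b) n, fun b n => hi (k b) n,
    hlo.comp (pair (hk.comp fst) snd), hhi.comp (pair (hk.comp fst) snd),
    fun b n => h1 _ _, fun b n => h2 _ _, fun b => h3 _, fun b => h4 _⟩

theorem add (hx : IsCompReal x) (hy : IsCompReal y) : IsCompReal fun a => x a + y a := by
  obtain ⟨lo, hi, hlo, hhi, h1, h2, h3, h4⟩ := hx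
  obtain ⟨lo', hi', hlo', hhi', h1', h2', h3', h4'⟩ := hy
  refine ⟨fun a n => lo a n + lo' a n, fun a n => hi a n + hi' a n, hlo.add hlo', hhi.add hhi',
    fun a n => ?_, fun a n => ?_, fun a => ?_, fun a => ?_⟩
  · push_cast; exact add_le_add (h1 a n) (h1' a n)
  · push_cast; exact add_le_add (h2 a n) (h2' a n)
  · push_cast; exact (h3 a).add (h3' a)
  · push_cast; exact (h4 a).add (h4' a)

/-- The lower bounds may be assumed to stay above a rational lower bound of the function. -/
theorem exists_bounds_ge (hx : IsCompReal x) (δ : ℚ) (hδ : ∀ a, (δ : ℝ) ≤ x a) :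
    ∃ lo hi : α → ℕ → ℚ, (IsCompRat fun p : α × ℕ => lo p.1 p.2) ∧
      (IsCompRat fun p : α × ℕ => hi p.1 p.2) ∧
      (∀ a n, (lo a n : ℝ) ≤ x a) ∧ (∀ a n, x a ≤ hi a n) ∧
      (∀ a, Tendsto (fun n => (lo a n : ℝ)) atTop (𝓝 (x a))) ∧
      (∀ a, Tendsto (fun n => (hi a n : ℝ)) atTop (𝓝 (x a))) ∧
      (∀ a n, δ ≤ lo a n) ∧ ∀ a n, δ ≤ hi a n := by
  obtain ⟨lo, hi, hlo, hhi, h1, h2, h3, h4⟩ := hx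
  refine ⟨fun a n => max (lo a n) δ, hi, hlo.max (IsCompRat.const δ), hhi,
    fun a n => ?_, h2, fun a => ?_, h4, fun a n => le_max_right _ _, fun a n => ?_⟩
  · push_cast
    exact max_le (h1 a n) (hδ a)
  · push_cast
    simpa [max_eq_left (hδ a)] using (h3 a).max (tendsto_const_nhds (x := (δ : ℝ)))
  · exact_mod_cast (hδ a).trans (h2 a n)

/-- Nonnegativity lets lower bounds multiply to lower bounds and upper bounds to upper bounds, with
no case distinction on signs. -/
theorem mul (hx : IsCompReal x) (hy : IsCompReal y) (hx0 : ∀ a, 0 ≤ x a) (hy0 : ∀ a, 0 ≤ y a) :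
    IsCompReal fun a => x a * y a := by
  obtain ⟨lo, hi, hlo, hhi, h1, h2, h3, h4, h5, h6⟩ := hx.exists_bounds_ge 0 (by simpa)
  obtain ⟨lo', hi', hlo', hhi', h1', h2', h3', h4', h5', h6'⟩ := hy.exists_bounds_ge 0 (by simpa)
  refine ⟨fun a n => lo a n * lo' a n, fun a n => hi a n * hi' a n, hlo.mul hlo', hhi.mul hhi',
    fun a n => ?_, fun a n => ?_, fun a => ?_, fun a => ?_⟩
  · push_cast
    exact mul_le_mul (h1 a n) (h1' a n) (by exact_mod_cast h5' a n) (hx0 a)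
  · push_cast
    exact mul_le_mul (h2 a n) (h2' a n) (hy0 a) (by exact_mod_cast h6 a n)
  · push_cast; exact (h3 a).mul (h3' a)
  · push_cast; exact (h4 a).mul (h4' a)

theorem pow (hx : IsCompReal x) (hx0 : ∀ a, 0 ≤ x a) {k : α → ℕ} (hk : Computable k) :
    IsCompReal fun a => x a ^ k a := by
  obtain ⟨lo, hi, hlo, hhi, h1, h2, h3, h4, h5, h6⟩ := hx.exists_bounds_ge 0 (by simpa)
  refine ⟨fun a n => lo a n ^ k a, fun a n => hi a n ^ k a, hlo.pow (hk.comp fst),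
    hhi.pow (hk.comp fst), fun a n => ?_, fun a n => ?_, fun a => ?_, fun a => ?_⟩
  · push_cast
    exact pow_le_pow_left₀ (by exact_mod_cast h5 a n) (h1 a n) _
  · push_cast
    exact pow_le_pow_left₀ (hx0 a) (h2 a n) _
  · push_cast; exact (h3 a).pow _
  · push_cast; exact (h4 a).pow _

theorem sumRange {F : α → ℕ → ℝ} (hF : IsCompReal fun p : α × ℕ => F p.1 p.2)
    {k : α → ℕ} (hk : Computable k) : IsCompReal fun a => ∑ i ∈ Finset.range (k a), F a i := by
  obtain ⟨lo, hi, hlo, hhi, h1, h2, h3, h4⟩ := hF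
  have hc : Computable fun q : (α × ℕ) × ℕ => ((q.1.1, q.2), q.1.2) :=
    pair (pair (fst.comp fst) snd) (snd.comp fst)
  refine ⟨fun a n => ∑ i ∈ Finset.range (k a), lo (a, i) n,
    fun a n => ∑ i ∈ Finset.range (k a), hi (a, i) n,
    IsCompRat.sumRange (F := fun (p : α × ℕ) i => lo (p.1, i) p.2) (hlo.comp hc) (hk.comp fst),
    IsCompRat.sumRange (F := fun (p : α × ℕ) i => hi (p.1, i) p.2) (hhi.comp hc) (hk.comp fst),
    fun a n => ?_, fun a n => ?_, fun a => ?_, fun a => ?_⟩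
  · push_cast
    exact Finset.sum_le_sum fun i _ => h1 (a, i) n
  · push_cast
    exact Finset.sum_le_sum fun i _ => h2 (a, i) n
  · push_cast
    exact tendsto_finsetSum _ fun i _ => h3 (a, i)
  · push_cast
    exact tendsto_finsetSum _ fun i _ => h4 (a, i)

theorem cond {p : α → Bool} (hp : Computable p) (hx : IsCompReal x) (hy : IsCompReal y) :
    IsCompReal fun a => if p a = true then x a else y a := by
  obtain ⟨lo, hi, hlo, hhi, h1, h2, h3, h4⟩ := hx
  obtain ⟨lo', hi', hlo', hhi', h1', h2', h3', h4'⟩ := hy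
  refine ⟨fun a n => if p a = true then lo a n else lo' a n,
    fun a n => if p a = true then hi a n else hi' a n,
    IsCompRat.cond (hp.comp fst) hlo hlo', IsCompRat.cond (hp.comp fst) hhi hhi',
    fun a n => ?_, fun a n => ?_, fun a => ?_, fun a => ?_⟩ <;>
  cases hpa : p a <;> simp [*]

/-- The rational `δ` keeps every approximation away from zero, so that all of them can be inverted.
-/
theorem inv (hx : IsCompReal x) {δ : ℚ} (hδ0 : 0 < δ) (hδ : ∀ a, (δ : ℝ) ≤ x a) :
    IsCompReal fun a => (x a)⁻¹ := by
  obtain ⟨lo, hi, hlo, hhi, h1, h2, h3, h4, h5, h6⟩ := hx.exists_bounds_ge δ hδ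
  have hx0 : ∀ a, 0 < x a := fun a => lt_of_lt_of_le (by exact_mod_cast hδ0) (hδ a)
  refine ⟨fun a n => (hi a n)⁻¹, fun a n => (lo a n)⁻¹, hhi.inv fun p => hδ0.trans_le (h6 _ _),
    hlo.inv fun p => hδ0.trans_le (h5 _ _), fun a n => ?_, fun a n => ?_, fun a => ?_, fun a => ?_⟩
  · push_cast
    exact inv_anti₀ (hx0 a) (h2 a n)
  · push_cast
    exact inv_anti₀ (by exact_mod_cast hδ0.trans_le (h5 a n)) (h1 a n)
  · push_cast
    exact (h4 a).inv₀ (hx0 a).ne'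
  · push_cast
    exact (h3 a).inv₀ (hx0 a).ne'

/-- Rational approximation with prescribed precision. -/
theorem exists_approx (hx : IsCompReal x) {m : α → ℕ} (hm : Computable m) :
    ∃ G : α → ℚ, IsCompRat G ∧ ∀ a, |(G a : ℝ) - x a| ≤ (1 / 2) ^ m a := by
  obtain ⟨lo, hi, hlo, hhi, h1, h2, h3, h4⟩ := hx
  have hp : Computable fun p : α × ℕ =>
      decide (hi p.1 p.2 - lo p.1 p.2 < (1 / 2) ^ m p.1) :=
    (hhi.sub hlo).decide_lt ((IsCompRat.const _).pow (hm.comp fst))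
  obtain ⟨F, hF, hF'⟩ := exists_search
    (p := fun a n => decide (hi a n - lo a n < (1 / 2) ^ m a)) hp fun a => by
      have ht := (h4 a).sub (h3 a)
      rw [sub_self] at ht
      obtain ⟨n, hn⟩ := (ht.eventually_lt_const
        (show (0 : ℝ) < (1 / 2) ^ m a by positivity)).exists
      exact ⟨n, decide_eq_true (by
        have : ((hi a n - lo a n : ℚ) : ℝ) < (((1 / 2) ^ m a : ℚ) : ℝ) := by push_cast; exact hn
        exact_mod_cast this)⟩
  refine ⟨fun a => lo a (F a), hlo.comp (Computable.id.pair hF), fun a => ?_⟩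
  have h := of_decide_eq_true (hF' a)
  have h' : ((hi a (F a) - lo a (F a) : ℚ) : ℝ) < (((1 / 2) ^ m a : ℚ) : ℝ) := by exact_mod_cast h
  push_cast at h'
  rw [abs_le]
  constructor <;> linarith [h1 a (F a), h2 a (F a)]

end IsCompReal

/-! ### Computable binary logarithms and exponentials -/

theorem exists_computable_log : ∃ lg : ℕ → ℕ, Computable lg ∧
    ∀ m, 0 < m → 2 ^ lg m ≤ m ∧ m < 2 ^ (lg m + 1) := by
  -- The disjunct for argument `0` only makes the search total; the value found there is irrelevant.
  have hp : Computable fun x : ℕ × ℕ =>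
      (decide (2 ^ x.2 ≤ x.1) && decide (x.1 < 2 ^ (x.2 + 1))) || decide (x.1 = 0) :=
    Primrec.or.to_comp.comp
      (((((Computable.const 2).natPow Computable.snd).decideLE Computable.fst)).boolAnd
        (Computable.fst.decideLT ((Computable.const 2).natPow
          (Computable.snd.natAdd (Computable.const 1)))))
      (Computable.fst.decideEq (Computable.const 0))
  obtain ⟨F, hF, h⟩ := Computable.exists_search (p := fun m k =>
    (decide (2 ^ k ≤ m) && decide (m < 2 ^ (k + 1))) || decide (m = 0)) hp fun m => by
      rcases Nat.eq_zero_or_pos m with rfl | hm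
      · exact ⟨0, by simp⟩
      · exact ⟨Nat.log 2 m, by
          simp [Nat.pow_log_le_self 2 hm.ne', Nat.lt_pow_succ_log_self (b := 2) (by norm_num) m]⟩
  refine ⟨F, hF, fun m hm => ?_⟩
  have := h m
  simpa [hm.ne'] using this

/-- Rational approximations to the binary logarithm. -/
theorem exists_compRat_logb {α : Type*} [Primcodable α] {f : α → ℕ → ℚ}
    (hf : IsCompRat fun p : α × ℕ => f p.1 p.2) (h0 : ∀ a n, 0 < f a n) :
    ∃ g : α → ℕ → ℚ, (IsCompRat fun p : α × ℕ => g p.1 p.2) ∧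
      ∀ a n, |(g a n : ℝ) - Real.logb 2 (f a n)| ≤ 1 / (n + 1) := by
  obtain ⟨lg, hlg, hl⟩ := exists_computable_log
  obtain ⟨m, d, hm, hd, h⟩ := hf.exists_nat_of_nonneg fun p => (h0 p.1 p.2).le
  have hk : Computable fun p : α × ℕ => p.2 + 1 := Computable.snd.natAdd (Computable.const 1)
  -- The integer logarithm of an `(n + 1)`-st power is off by at most one, so after division by `n +
  -- 1` the error is at most `1 / (n + 1)`. The errors for numerator and denominator have the same
  -- sign and do not add up.
  refine ⟨fun a n => ((lg (m (a, n) ^ (n + 1)) : ℚ) - lg ((d (a, n) + 1) ^ (n + 1))) / (n + 1),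
    IsCompRat.mk (hlg.comp (hm.natPow hk))
      (hlg.comp ((hd.natAdd (Computable.const 1)).natPow hk)) Computable.snd fun _ => rfl,
    fun a n => ?_⟩
  have hm0 : 0 < m (a, n) := by
    have h1 := h0 a n
    rw [show f a n = _ from h (a, n), lt_div_iff₀ (by positivity), zero_mul, Nat.cast_pos] at h1
    exact h1
  have key : ∀ M : ℕ, 0 < M → (lg M : ℝ) ≤ Real.logb 2 M ∧ Real.logb 2 M ≤ lg M + 1 := by
    intro M hM
    obtain ⟨h1, h2⟩ := hl M hM
    have hM' : (0 : ℝ) < M := by exact_mod_cast hM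
    constructor
    · rw [Real.le_logb_iff_rpow_le one_lt_two hM', Real.rpow_natCast]
      exact_mod_cast h1
    · rw [Real.logb_le_iff_le_rpow one_lt_two hM']
      rw [show (lg M : ℝ) + 1 = ((lg M + 1 : ℕ) : ℝ) by push_cast; rfl, Real.rpow_natCast]
      exact_mod_cast h2.le
  have k1 := key (m (a, n) ^ (n + 1)) (by positivity)
  have k2 := key ((d (a, n) + 1) ^ (n + 1)) (by positivity)
  push_cast at k1 k2
  rw [← Real.rpow_natCast, Real.logb_rpow_eq_mul_logb_of_pos (by exact_mod_cast hm0)] at k1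
  rw [← Real.rpow_natCast, Real.logb_rpow_eq_mul_logb_of_pos (by positivity)] at k2
  rw [show f a n = _ from h (a, n)]
  push_cast at k1 k2 ⊢
  rw [Real.logb_div (by exact_mod_cast hm0.ne') (by positivity)]
  have hn : (0 : ℝ) < n + 1 := by positivity
  rw [div_sub' hn.ne', abs_div, abs_of_pos hn]
  refine div_le_div_of_nonneg_right ?_ hn.le
  rw [abs_le]
  constructor <;> linarith [k1.1, k1.2, k2.1, k2.2]

/-- Rational approximations to `t ↦ 2 ^ (-t)`. -/
theorem exists_compRat_two_rpow_neg {α : Type*} [Primcodable α] {f : α → ℕ → ℚ}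
    (hf : IsCompRat fun p : α × ℕ => f p.1 p.2) (h0 : ∀ a n, 0 ≤ f a n) :
    ∃ g : α → ℕ → ℚ, (IsCompRat fun p : α × ℕ => g p.1 p.2) ∧
      ∀ a n, (g a n : ℝ) ≤ 2 ^ (-(f a n : ℝ)) ∧ 2 ^ (-(f a n : ℝ)) ≤ (g a n : ℝ) + 1 / (n + 1) := by
  obtain ⟨m, d, hm, hd, h⟩ := hf.exists_nat_of_nonneg fun p => h0 p.1 p.2
  have hm1 := hm.comp (Computable.fst (β := ℕ))
  have hd1 := (hd.comp (Computable.fst (β := ℕ))).natAdd (Computable.const 1)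
  have hn1 : Computable fun q : (α × ℕ) × ℕ => q.1.2 + 1 :=
    (Computable.snd.comp Computable.fst).natAdd (Computable.const 1)
  -- With `f = m / D` and `D = d + 1`, the two tests say that `k / (n + 1)` and `(k + 1) / (n + 1)`
  -- enclose `2^(-m / D)`, after taking `D`-th powers and clearing denominators.
  have hp : Computable fun q : (α × ℕ) × ℕ =>
      decide (q.2 ^ (d q.1 + 1) * 2 ^ m q.1 ≤ (q.1.2 + 1) ^ (d q.1 + 1)) &&
      decide ((q.1.2 + 1) ^ (d q.1 + 1) ≤ (q.2 + 1) ^ (d q.1 + 1) * 2 ^ m q.1) :=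
    Computable.boolAnd
      ((((Computable.snd.natPow hd1).natMul ((Computable.const 2).natPow hm1))).decideLE
        (hn1.natPow hd1))
      ((hn1.natPow hd1).decideLE
        (((Computable.snd.natAdd (Computable.const 1)).natPow hd1).natMul
          ((Computable.const 2).natPow hm1)))
  obtain ⟨F, hF, hF'⟩ := Computable.exists_search (p := fun (q : α × ℕ) k =>
      decide (k ^ (d q + 1) * 2 ^ m q ≤ (q.2 + 1) ^ (d q + 1)) &&
      decide ((q.2 + 1) ^ (d q + 1) ≤ (k + 1) ^ (d q + 1) * 2 ^ m q)) hp fun q => by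
    -- The least `k` passing the second test also passes the first, because `k - 1` fails the
    -- second.
    have hex : ∃ k, (q.2 + 1) ^ (d q + 1) ≤ (k + 1) ^ (d q + 1) * 2 ^ m q :=
      ⟨q.2, Nat.le_mul_of_pos_right _ (by positivity)⟩
    refine ⟨Nat.find hex, ?_⟩
    rw [Bool.and_eq_true, decide_eq_true_eq, decide_eq_true_eq]
    refine ⟨?_, Nat.find_spec hex⟩
    rcases hk : Nat.find hex with _ | k
    · simp
    · exact (not_le.1 (Nat.find_min hex (m := k) (by omega))).le
  refine ⟨fun a n => (F (a, n) : ℚ) / (n + 1),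
    IsCompRat.mk hF (Computable.const 0) Computable.snd fun _ => by simp, fun a n => ?_⟩
  have h1 := hF' (a, n)
  rw [Bool.and_eq_true, decide_eq_true_eq, decide_eq_true_eq] at h1
  obtain ⟨h1, h2⟩ := h1
  have hn : (0 : ℝ) < n + 1 := by positivity
  set D := d (a, n) + 1 with hD
  have hpow : ((2 : ℝ) ^ (-(f a n : ℝ))) ^ D * 2 ^ m (a, n) = 1 := by
    rw [← Real.rpow_natCast, ← Real.rpow_mul (by norm_num), ← Real.rpow_natCast 2 (m (a, n)),
      ← Real.rpow_add (by norm_num), show f a n = _ from h (a, n)]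
    push_cast
    rw [hD]
    push_cast
    rw [neg_mul, div_mul_cancel₀ _ (by positivity), neg_add_cancel, Real.rpow_zero]
  have hD0 : D ≠ 0 := by omega
  have hb : (0 : ℝ) ≤ 2 ^ (-(f a n : ℝ)) := by positivity
  have h2m : (0 : ℝ) < 2 ^ m (a, n) := by positivity
  have h1' : ((F (a, n) : ℝ)) ^ D * 2 ^ m (a, n) ≤ (n + 1) ^ D := by exact_mod_cast h1
  have h2' : ((n : ℝ) + 1) ^ D ≤ (F (a, n) + 1) ^ D * 2 ^ m (a, n) := by exact_mod_cast h2
  push_cast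
  constructor
  · rw [div_le_iff₀ hn]
    refine le_of_pow_le_pow_left₀ hD0 (by positivity) ?_
    rw [mul_pow]
    refine le_of_mul_le_mul_right ?_ h2m
    calc _ ≤ ((n : ℝ) + 1) ^ D := h1'
      _ = _ := by rw [mul_right_comm, hpow, one_mul]
  · rw [← add_div, le_div_iff₀ hn]
    refine le_of_pow_le_pow_left₀ hD0 (by positivity) ?_
    rw [mul_pow]
    refine le_of_mul_le_mul_right ?_ h2m
    calc _ = ((n : ℝ) + 1) ^ D := by rw [mul_right_comm, hpow, one_mul]
      _ ≤ _ := h2'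

namespace IsCompReal

variable {α : Type*} [Primcodable α] {x : α → ℝ}

theorem tendsto_one_div_succ : Tendsto (fun n : ℕ => (1 : ℝ) / (n + 1)) atTop (𝓝 0) :=
  tendsto_one_div_add_atTop_nhds_zero_nat

theorem logb (hx : IsCompReal x) {δ : ℚ} (hδ0 : 0 < δ) (hδ : ∀ a, (δ : ℝ) ≤ x a) :
    IsCompReal fun a => Real.logb 2 (x a) := by
  obtain ⟨lo, hi, hlo, hhi, h1, h2, h3, h4, h5, h6⟩ := hx.exists_bounds_ge δ hδ
  have hx0 : ∀ a, 0 < x a := fun a => lt_of_lt_of_le (by exact_mod_cast hδ0) (hδ a)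
  have hlo0 : ∀ a n, 0 < lo a n := fun a n => hδ0.trans_le (h5 a n)
  have hhi0 : ∀ a n, 0 < hi a n := fun a n => hδ0.trans_le (h6 a n)
  obtain ⟨g, hg, hg'⟩ := exists_compRat_logb hlo hlo0
  obtain ⟨g', hg1, hg1'⟩ := exists_compRat_logb hhi hhi0
  have herr : IsCompRat fun p : α × ℕ => (1 : ℚ) / (p.2 + 1) :=
    IsCompRat.mk (Computable.const 1) (Computable.const 0) Computable.snd fun _ => by simp
  have hlim : ∀ (u : ℕ → ℚ) (v : ℕ → ℚ) (y : ℝ), 0 < y →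
      Tendsto (fun n => (u n : ℝ)) atTop (𝓝 y) →
      (∀ n, |(v n : ℝ) - Real.logb 2 (u n)| ≤ 1 / (n + 1)) →
      Tendsto (fun n => (v n : ℝ)) atTop (𝓝 (Real.logb 2 y)) := by
    intro u v y hy hu hv
    have h1 : Tendsto (fun n => (v n : ℝ) - Real.logb 2 (u n)) atTop (𝓝 0) :=
      squeeze_zero_norm hv tendsto_one_div_succ
    have h2 : Tendsto (fun n => Real.logb 2 (u n : ℝ)) atTop (𝓝 (Real.logb 2 y)) :=
      (Real.continuousAt_logb hy.ne').tendsto.comp hu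
    simpa using h1.add h2
  refine ⟨fun a n => g a n - 1 / (n + 1), fun a n => g' a n + 1 / (n + 1), hg.sub herr,
    hg1.add herr, fun a n => ?_, fun a n => ?_, fun a => ?_, fun a => ?_⟩
  · have k1 := (abs_le.1 (hg' a n)).2
    have k2 := Real.logb_le_logb_of_le one_lt_two (by exact_mod_cast hlo0 a n) (h1 a n)
    push_cast
    linarith
  · have k1 := (abs_le.1 (hg1' a n)).1
    have k2 := Real.logb_le_logb_of_le one_lt_two (hx0 a) (h2 a n)
    push_cast
    linarith
  · push_cast
    simpa using (hlim _ _ _ (hx0 a) (h3 a) (hg' a)).sub tendsto_one_div_succ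
  · push_cast
    simpa using (hlim _ _ _ (hx0 a) (h4 a) (hg1' a)).add tendsto_one_div_succ

theorem two_rpow_neg (hx : IsCompReal x) (hx0 : ∀ a, 0 ≤ x a) :
    IsCompReal fun a => (2 : ℝ) ^ (-x a) := by
  obtain ⟨lo, hi, hlo, hhi, h1, h2, h3, h4, h5, h6⟩ := hx.exists_bounds_ge 0 (by simpa)
  -- The function is decreasing: upper bounds of `x` give the lower bounds here, and conversely.
  obtain ⟨g, hg, hg'⟩ := exists_compRat_two_rpow_neg hhi h6
  obtain ⟨g', hg1, hg1'⟩ := exists_compRat_two_rpow_neg hlo h5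
  have herr : IsCompRat fun p : α × ℕ => (1 : ℚ) / (p.2 + 1) :=
    IsCompRat.mk (Computable.const 1) (Computable.const 0) Computable.snd fun _ => by simp
  have hlim : ∀ (u : ℕ → ℚ) (v : ℕ → ℚ) (y : ℝ),
      Tendsto (fun n => (u n : ℝ)) atTop (𝓝 y) →
      (∀ n, (v n : ℝ) ≤ 2 ^ (-(u n : ℝ)) ∧ (2 : ℝ) ^ (-(u n : ℝ)) ≤ v n + 1 / (n + 1)) →
      Tendsto (fun n => (v n : ℝ)) atTop (𝓝 ((2 : ℝ) ^ (-y))) := by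
    intro u v y hu hv
    have h2 : Tendsto (fun n => (2 : ℝ) ^ (-(u n : ℝ))) atTop (𝓝 ((2 : ℝ) ^ (-y))) :=
      tendsto_const_nhds.rpow hu.neg (Or.inl two_ne_zero)
    have h3 : Tendsto (fun n : ℕ => (2 : ℝ) ^ (-(u n : ℝ)) - 1 / (n + 1)) atTop
        (𝓝 ((2 : ℝ) ^ (-y))) := by simpa using h2.sub tendsto_one_div_succ
    exact tendsto_of_tendsto_of_tendsto_of_le_of_le h3 h2
      (fun n => by simpa [sub_le_iff_le_add] using (hv n).2) fun n => (hv n).1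
  refine ⟨g, fun a n => g' a n + 1 / (n + 1), hg,
    hg1.add herr, fun a n => ?_, fun a n => ?_, fun a => ?_, fun a => ?_⟩
  · exact (hg' a n).1.trans (Real.rpow_le_rpow_of_exponent_le one_le_two (neg_le_neg (h2 a n)))
  · push_cast
    exact (Real.rpow_le_rpow_of_exponent_le one_le_two (neg_le_neg (h1 a n))).trans (hg1' a n).2
  · exact hlim _ _ _ (h4 a) (hg' a)
  · push_cast
    simpa using (hlim _ _ _ (h3 a) (hg1' a)).add tendsto_one_div_succ

/-- A computable real number, as a constant function. -/
theorem of_isComputableReal {T : ℝ} (hT : IsComputableReal T) :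
    IsCompReal fun _ : α => T := by
  obtain ⟨f, hf, h⟩ := hT
  have hf1 : IsCompRat fun p : α × ℕ => f (p.2 + 1) :=
    (IsCompRat.of_isRecursiveRat hf).comp (Computable.snd.natAdd (Computable.const 1))
  have herr : IsCompRat fun p : α × ℕ => (1 : ℚ) / (p.2 + 1) :=
    IsCompRat.mk (Computable.const 1) (Computable.const 0) Computable.snd fun _ => by simp
  have hb : ∀ n : ℕ, |T - f (n + 1)| ≤ 1 / (n + 1) := fun n => by
    simpa using (h (n + 1) (by omega)).le
  have hlim : Tendsto (fun n => (f (n + 1) : ℝ)) atTop (𝓝 T) := by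
    have h1 : Tendsto (fun n => T - f (n + 1)) atTop (𝓝 0) :=
      squeeze_zero_norm hb tendsto_one_div_succ
    simpa using (tendsto_const_nhds (x := T)).sub h1
  refine ⟨fun _ n => f (n + 1) - 1 / (n + 1), fun _ n => f (n + 1) + 1 / (n + 1), hf1.sub herr,
    hf1.add herr, fun a n => ?_, fun a n => ?_, fun a => ?_, fun a => ?_⟩
  · push_cast; linarith [(abs_le.1 (hb n)).1]
  · push_cast; linarith [(abs_le.1 (hb n)).2]
  · push_cast; simpa using hlim.sub tendsto_one_div_succ
  · push_cast; simpa using hlim.add tendsto_one_div_succ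

end IsCompReal

/-! ### Program-size complexity -/

theorem complexity_le_length {U : List Bool →. List Bool} {p s : List Bool} (h : s ∈ U p) :
    complexity U s ≤ p.length :=
  Nat.sInf_le ⟨p, h, rfl⟩

theorem IsOptimal.exists_shortest_program {U : List Bool →. List Bool} (hU : IsOptimal U)
    (s : List Bool) : ∃ p, s ∈ U p ∧ p.length = complexity U s := by
  obtain ⟨p, hp⟩ := hU.exists_program s
  exact Nat.sInf_mem (s := {l | ∃ p : List Bool, s ∈ U p ∧ p.length = l}) ⟨_, p, hp, rfl⟩

/-- Following `U` by a partial recursive `h` only shrinks the prefix-free domain of `U`, so the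
composition is again a computer. -/
theorem IsOptimal.complexity_bind_le {U : List Bool →. List Bool} (hU : IsOptimal U)
    {h : List Bool →. List Bool} (hh : Partrec h) :
    ∃ c : ℕ, ∀ v x, x ∈ h v → complexity U x ≤ complexity U v + c := by
  obtain ⟨c, hc⟩ := hU.2 (fun p => (U p).bind h)
    ⟨hU.1.partrec.bind (hh.comp Computable.snd), fun p hp p' hp' hpp' => by
      obtain ⟨y, hy⟩ := (PFun.mem_dom _ _).1 hp
      obtain ⟨y', hy'⟩ := (PFun.mem_dom _ _).1 hp'
      obtain ⟨z, hz, -⟩ := Part.mem_bind_iff.1 hy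
      obtain ⟨z', hz', -⟩ := Part.mem_bind_iff.1 hy'
      exact hU.1.prefixFree p ((PFun.mem_dom _ _).2 ⟨z, hz⟩) p'
        ((PFun.mem_dom _ _).2 ⟨z', hz'⟩) hpp'⟩
  refine ⟨c, fun v x hx => ?_⟩
  obtain ⟨p, hp, hl⟩ := hU.exists_shortest_program v
  obtain ⟨p', hp', hl'⟩ := hc p x (Part.mem_bind_iff.2 ⟨v, hp, hx⟩)
  exact (complexity_le_length hp').trans (hl ▸ hl')

/-- The complexity of a string computed from `v` by unbounded search from `v` exceeds that of `v` by at most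
a constant. -/
theorem IsOptimal.complexity_search_le {U : List Bool →. List Bool} (hU : IsOptimal U)
    {p : List Bool → ℕ → Bool} (hp : Computable fun x : List Bool × ℕ => p x.1 x.2)
    {out : List Bool → ℕ → List Bool} (ho : Computable fun x : List Bool × ℕ => out x.1 x.2) :
    ∃ c : ℕ, ∀ v, (∃ s, p v s = true) →
      complexity U (out v (sInf {s | p v s = true})) ≤ complexity U v + c := by
  have hp' : Partrec₂ fun v n => (p v n : Part Bool) := Computable.partrec hp
  have hr : Partrec fun v => (Nat.rfind fun n => (p v n : Part Bool)).map (out v) :=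
    (Partrec.rfind hp').map ho
  obtain ⟨c, hc⟩ := hU.complexity_bind_le hr
  refine ⟨c, fun v hv => hc _ _ (Part.mem_map _ (Nat.mem_rfind.2 ⟨?_, fun {m} hm => ?_⟩))⟩
  · simpa using Nat.sInf_mem (s := {s | p v s = true}) hv
  · simpa using Nat.notMem_of_lt_sInf hm

/-! ### Self-delimiting strings -/

/-- The strings consisting of `j` ones, a zero, and `φ j` arbitrary bits, for some `j`. -/
def selfDelimiting (φ : ℕ → ℕ) : Set (List Bool) :=
  {q | q.length = q.idxOf false + 1 + φ (q.idxOf false)}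

theorem idxOf_false_replicate (j : ℕ) (v : List Bool) :
    (List.replicate j true ++ false :: v).idxOf false = j := by
  rw [List.idxOf_append_of_notMem (by simp [List.mem_replicate])]
  simp

theorem replicate_append_mem_selfDelimiting {φ : ℕ → ℕ} {j : ℕ} {v : List Bool}
    (hv : v.length = φ j) : List.replicate j true ++ false :: v ∈ selfDelimiting φ := by
  simp only [selfDelimiting, Set.mem_ofPred_eq, idxOf_false_replicate]
  simp [hv]; ring

/-- The first zero determines the total length, and a prefix that contains it has the same first
zero. -/
theorem selfDelimiting_prefixFree {φ : ℕ → ℕ} {q q' : List Bool} (hq : q ∈ selfDelimiting φ)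
    (hq' : q' ∈ selfDelimiting φ) (h : q <+: q') : q = q' := by
  obtain ⟨t, rfl⟩ := h
  simp only [selfDelimiting, Set.mem_ofPred_eq] at hq hq'
  -- Without a zero, `idxOf` would return the length of `q`, contradicting `hq`.
  have hmem : false ∈ q := List.idxOf_lt_length_iff.1 (by omega)
  rw [List.idxOf_append_of_mem hmem, ← hq, List.length_append] at hq'
  rw [List.length_eq_zero_iff.1 (by omega : t.length = 0), List.append_nil]

/-- The identity restricted to this decidable prefix-free set is a computer. -/
theorem IsOptimal.exists_program_selfDelimiting {U : List Bool →. List Bool} (hU : IsOptimal U)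
    {φ : ℕ → ℕ} (hφ : Computable φ) :
    ∃ c : ℕ, ∀ q ∈ selfDelimiting φ, ∃ p, q ∈ U p ∧ p.length ≤ q.length + c := by
  have hidx : Computable fun q : List Bool => q.idxOf false :=
    (Primrec.list_idxOf (α := Bool)).to_comp.comp (Computable.const false) Computable.id
  have hd : Computable fun q : List Bool =>
      decide (q.length = q.idxOf false + 1 + φ (q.idxOf false)) :=
    Computable.list_length.decideEq ((hidx.natAdd (Computable.const 1)).natAdd (hφ.comp hidx))
  have hC : Computable fun q : List Bool =>
      bif decide (q.length = q.idxOf false + 1 + φ (q.idxOf false)) then some q else none :=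
    Computable.cond hd Computable.option_some (Computable.const none)
  have hmem : ∀ q x : List Bool, x ∈ ((bif decide (q.length = q.idxOf false + 1 +
      φ (q.idxOf false)) then some q else none : Option (List Bool)) : Part (List Bool)) ↔
      q ∈ selfDelimiting φ ∧ x = q := by
    intro q x
    by_cases h : q.length = q.idxOf false + 1 + φ (q.idxOf false)
    · simp [selfDelimiting, ← h, eq_comm]
    · simp [selfDelimiting, h]
  obtain ⟨c, hc⟩ := hU.2 _ ⟨hC.ofOption, fun p h p' h' hpp' => by
    obtain ⟨y, hy⟩ := (PFun.mem_dom _ _).1 h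
    obtain ⟨y', hy'⟩ := (PFun.mem_dom _ _).1 h'
    exact selfDelimiting_prefixFree ((hmem _ _).1 hy).1 ((hmem _ _).1 hy').1 hpp'⟩
  exact ⟨c, fun q hq => hc q q ((hmem q q).2 ⟨hq, rfl⟩)⟩

/-! ### Binary numerals -/

/-- The last `n` binary digits of `N`, the most significant one first. -/
def toBits (n N : ℕ) : List Bool :=
  (List.range n).map fun i => decide (N / 2 ^ (n - 1 - i) % 2 = 1)

/-- The natural number with binary digits `l`, the most significant one first. -/
def bitsVal (l : List Bool) : ℕ := l.foldl (fun a b => 2 * a + bif b then 1 else 0) 0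

@[simp] theorem length_toBits (n N : ℕ) : (toBits n N).length = n := by simp [toBits]

theorem toBits_succ (n N : ℕ) : toBits (n + 1) N = toBits n (N / 2) ++ [decide (N % 2 = 1)] := by
  rw [toBits, List.range_succ, List.map_append, toBits]
  congr 1
  · refine List.map_congr_left fun i hi => ?_
    rw [List.mem_range] at hi
    rw [Nat.div_div_eq_div_mul, ← pow_succ', show n + 1 - 1 - i = n - 1 - i + 1 by omega]
  · simp

theorem bitsVal_toBits {n N : ℕ} (h : N < 2 ^ n) : bitsVal (toBits n N) = N := by
  induction n generalizing N with
  | zero =>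
    obtain rfl : N = 0 := by simpa using h
    rfl
  | succ n ih =>
    have h1 := ih (N := N / 2) (by rw [pow_succ] at h; omega)
    rw [bitsVal] at h1
    rw [toBits_succ, bitsVal, List.foldl_append, h1]
    rcases Nat.mod_two_eq_zero_or_one N with h2 | h2 <;> simp [h2] <;> omega

theorem computable_toBits : Computable fun p : ℕ × ℕ => toBits p.1 p.2 := by
  have hpow : Primrec₂ ((· ^ ·) : ℕ → ℕ → ℕ) := Primrec₂.unpaired'.1 Nat.Primrec.pow
  refine Primrec.to_comp (Primrec.list_map (Primrec.list_range.comp Primrec.fst) ?_)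
  refine PrimrecPred.decide (Primrec.eq.comp ?_ (Primrec.const 1))
  exact Primrec.nat_mod.comp (Primrec.nat_div.comp (Primrec.snd.comp Primrec.fst)
    (hpow.comp (Primrec.const 2) (Primrec.nat_sub.comp
      (Primrec.nat_sub.comp (Primrec.fst.comp Primrec.fst) (Primrec.const 1)) Primrec.snd)))
    (Primrec.const 2)

theorem computable_bitsVal : Computable bitsVal := by
  refine Primrec.to_comp (Primrec.list_foldl (h := fun _ s => 2 * s.1 + bif s.2 then 1 else 0)
    Primrec.id (Primrec.const 0) ?_)
  exact Primrec.nat_add.comp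
    (Primrec.nat_mul.comp (Primrec.const 2) (Primrec.fst.comp Primrec.snd))
    (Primrec.cond (Primrec.snd.comp Primrec.snd) (Primrec.const 1) (Primrec.const 0))

theorem computable_replicate_true : Computable fun n : ℕ => List.replicate n true := by
  have h : Primrec fun n : ℕ => (List.range n).map fun _ => true :=
    Primrec.list_map Primrec.list_range (Primrec.const true)
  exact h.to_comp.of_eq fun n => by simp

/-- Dropping the last `n - 1 - i` binary digits of `⌊y * 2^n⌋` leaves `⌊y * 2^(i+1)⌋`, whose parity
is the `i`-th digit of `y`. -/
theorem bitPrefix_binaryExpansion (x : ℝ) (n : ℕ) :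
    bitPrefix (binaryExpansion x) n = toBits n ⌊Int.fract x * 2 ^ n⌋₊ := by
  refine List.map_congr_left fun i hi => ?_
  rw [List.mem_range] at hi
  have h1 : ⌊Int.fract x * 2 ^ n⌋₊ / 2 ^ (n - 1 - i) = ⌊Int.fract x * 2 ^ (i + 1)⌋₊ := by
    rw [← Nat.floor_div_natCast]
    congr 1
    have : (2 : ℝ) ^ n = 2 ^ (i + 1) * 2 ^ (n - 1 - i) := by
      rw [← pow_add]; congr 1; omega
    rw [this]
    push_cast
    field_simp
  rw [h1, binaryExpansion, decide_eq_decide, Real.digits, Fin.ext_iff]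
  simp

/-! ### Recursive approximation of the domain of a computer -/

open Nat.Partrec (Code) in
/-- The domain of a partial recursive function, enumerated by `q`, is exhausted by a recursive
sequence of finite sets. -/
theorem IsEnumeration.exists_stages {U : List Bool →. List Bool} (hU : Partrec U)
    {q : ℕ → List Bool} (hq : IsEnumeration q U) :
    ∃ (halt : ℕ → ℕ → Bool) (len bound : ℕ → ℕ) (E : ℕ → Finset ℕ),
      (Computable fun p : ℕ × ℕ => halt p.1 p.2) ∧ Computable len ∧ Computable bound ∧
      Monotone E ∧ (∀ k, ∃ s, k ∈ E s) ∧
      (∀ (s : ℕ) (f : ℕ → ℝ), ∑ k ∈ E s, f (q k).length =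
        ∑ i ∈ Finset.range s, if halt s i = true then f (len i) else 0) ∧
      ∀ s, ∀ k ∈ E s, ∀ x ∈ U (q k), x.length < bound s := by
  obtain ⟨c, hc⟩ := Code.exists_code.1 hU
  have heval : ∀ p, Code.eval c (Encodable.encode p) = (U p).map Encodable.encode := by
    intro p
    rw [hc]
    simp
  have hev : Computable fun p : ℕ × ℕ => Code.evaln p.1 c p.2 :=
    (Code.primrec_evaln.comp
      ((Primrec.fst.pair (Primrec.const c)).pair Primrec.snd)).to_comp
  have hdec : Computable fun i : ℕ => (Encodable.decode i : Option (List Bool)).getD [] :=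
    Computable.option_getD Computable.decode (Computable.const [])
  -- Decoding is only known to undo encoding, so several numbers might decode to one string; only
  -- its canonical code is kept.
  let valid : ℕ → Bool := fun i =>
    decide (Encodable.encode ((Encodable.decode i : Option (List Bool)).getD []) = i)
  have hvalid : ∀ p : List Bool, valid (Encodable.encode p) = true := fun p => by simp [valid]
  have hhalt : Computable fun p : ℕ × ℕ => (Code.evaln p.1 c p.2).isSome && valid p.2 :=
    (Primrec.option_isSome.to_comp.comp hev).boolAnd
      (((Computable.encode.comp hdec).decideEq Computable.id).comp Computable.snd)
  have hout : Computable fun p : ℕ × ℕ =>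
      ((Encodable.decode ((Code.evaln p.1 c p.2).getD 0) : Option (List Bool)).getD []).length :=
    Computable.list_length.comp (hdec.comp (Computable.option_getD hev (Computable.const 0)))
  have hinj : Function.Injective fun k => Encodable.encode (q k) :=
    Encodable.encode_injective.comp hq.1
  refine ⟨fun s i => (Code.evaln s c i).isSome && valid i,
    fun i => ((Encodable.decode i : Option (List Bool)).getD []).length,
    -- The total length of the outputs bounds each of them. Codes that have not halted contribute a
    -- default, harmless in an upper bound.
    fun s => (∑ i ∈ Finset.range s, ((Encodable.decode ((Code.evaln s c i).getD 0) :
      Option (List Bool)).getD []).length) + 1,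
    -- The recursive set of halted codes is pulled back along `q`. As `q` need not be recursive,
    -- neither need the index sets be; only sums depending on program lengths are computed.
    fun s => ((Finset.range s).filter fun i => ((Code.evaln s c i).isSome && valid i) = true).preimage
      (fun k => Encodable.encode (q k)) hinj.injOn, hhalt, Computable.list_length.comp hdec,
    (Computable.sumRange Computable.id (F := fun s i => ((Encodable.decode
      ((Code.evaln s c i).getD 0) : Option (List Bool)).getD []).length) hout).natAdd
      (Computable.const 1), ?_, ?_, ?_, ?_⟩
  · intro s t hst k hk
    simp only [Finset.mem_preimage, Finset.mem_filter, Finset.mem_range, hvalid,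
      Bool.and_true] at hk ⊢
    obtain ⟨y, hy⟩ := Option.isSome_iff_exists.1 hk.2
    exact ⟨hk.1.trans_le hst, Option.isSome_iff_exists.2 ⟨y, Code.evaln_mono hst hy⟩⟩
  · intro k
    have hk : q k ∈ U.Dom := hq.2 ▸ Set.mem_range_self k
    obtain ⟨x, hx⟩ := (PFun.mem_dom _ _).1 hk
    obtain ⟨s, hs⟩ := Code.evaln_complete.1
      (heval (q k) ▸ Part.mem_map Encodable.encode hx)
    refine ⟨s, ?_⟩
    simp only [Finset.mem_preimage, Finset.mem_filter, Finset.mem_range, hvalid,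
      Bool.and_true]
    exact ⟨Code.evaln_bound hs, Option.isSome_iff_exists.2 ⟨_, hs⟩⟩
  · intro s f
    have h := Finset.sum_preimage (fun k => Encodable.encode (q k))
      ((Finset.range s).filter fun i => ((Code.evaln s c i).isSome && valid i) = true) hinj.injOn
      (fun i => f ((Encodable.decode i : Option (List Bool)).getD []).length) fun i hi hi' => by
        exfalso
        obtain ⟨hi1, hi2⟩ := (Bool.and_eq_true_iff).1 (Finset.mem_filter.1 hi).2
        obtain ⟨y, hy⟩ := Option.isSome_iff_exists.1 hi1
        have hy' := Code.evaln_sound hy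
        rw [hc] at hy'
        obtain ⟨p, hp, hpy⟩ := Part.mem_bind_iff.1 hy'
        obtain ⟨x, hx, -⟩ := (Part.mem_map_iff _).1 hpy
        have hpd : p ∈ Set.range q := hq.2 ▸ (PFun.mem_dom _ _).2 ⟨x, hx⟩
        obtain ⟨k, rfl⟩ := hpd
        refine hi' ⟨k, ?_⟩
        have hi3 := of_decide_eq_true hi2
        rwa [Part.mem_ofOption.1 hp, Option.getD_some] at hi3
    rw [← Finset.sum_filter, ← h]
    simp
  · intro s k hk x hx
    simp only [Finset.mem_preimage, Finset.mem_filter, Finset.mem_range, hvalid,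
      Bool.and_true] at hk
    obtain ⟨y, hy⟩ := Option.isSome_iff_exists.1 hk.2
    have hy' := Code.evaln_sound hy
    rw [heval, Part.mem_map_iff] at hy'
    obtain ⟨z, hz, rfl⟩ := hy'
    obtain rfl := Part.mem_unique hx hz
    have h := Finset.single_le_sum (f := fun i => ((Encodable.decode
      ((Code.evaln s c i).getD 0) : Option (List Bool)).getD []).length)
      (fun _ _ => Nat.zero_le _) (Finset.mem_range.2 hk.1)
    simp only [hy, Option.getD_some, Encodable.encodek] at h
    exact Nat.lt_succ_of_le h

/-! ### Kraft's inequality -/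

/-- The first words of two factorizations are prefixes of one string, hence comparable, hence equal,
and can be cancelled. -/
theorem uniquelyDecodable_of_prefixFree {S : Set (List Bool)}
    (hS : ∀ p ∈ S, ∀ p' ∈ S, p <+: p' → p = p') (h0 : [] ∉ S) :
    InformationTheory.UniquelyDecodable S := by
  intro L₁
  induction L₁ with
  | nil =>
    intro L₂ _ h2 h
    rcases L₂ with _ | ⟨b, L₂⟩
    · rfl
    · simp only [List.flatten_nil, List.flatten_cons, List.nil_eq, List.append_eq_nil_iff] at h
      exact absurd (h.1 ▸ h2 b (by simp)) h0
  | cons a L₁ ih =>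
    intro L₂ h1 h2 h
    rcases L₂ with _ | ⟨b, L₂⟩
    · simp only [List.flatten_nil, List.flatten_cons, List.append_eq_nil_iff] at h
      exact absurd (h.1 ▸ h1 a (by simp)) h0
    · simp only [List.flatten_cons] at h
      have ha := h1 a (by simp)
      have hb := h2 b (by simp)
      have hab : a = b := by
        rcases List.prefix_or_prefix_of_prefix (List.prefix_append a L₁.flatten)
          (h ▸ List.prefix_append b L₂.flatten) with h' | h'
        · exact hS a ha b hb h'
        · exact (hS b hb a ha h').symm
      subst hab
      rw [ih L₂ (fun w hw => h1 w (by simp [hw])) (fun w hw => h2 w (by simp [hw]))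
        (List.append_cancel_left h)]

/-- An empty program would be a prefix of every other one, but the domain is infinite. -/
theorem IsEnumeration.one_le_length {U : List Bool →. List Bool} (hU : IsComputer U)
    {q : ℕ → List Bool} (hq : IsEnumeration q U) (i : ℕ) : 1 ≤ (q i).length := by
  rw [Nat.one_le_iff_ne_zero, ne_eq, List.length_eq_zero_iff]
  intro h
  have hmem : ∀ k, q k ∈ U.Dom := fun k => hq.2 ▸ Set.mem_range_self k
  have := hq.1 (hU.prefixFree (q i) (hmem i) (q (i + 1)) (hmem _) (h ▸ List.nil_prefix))
  omega

theorem IsEnumeration.kraft {U : List Bool →. List Bool} (hU : IsComputer U)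
    {q : ℕ → List Bool} (hq : IsEnumeration q U) (F : Finset ℕ) :
    ∑ i ∈ F, (1 / 2 : ℝ) ^ (q i).length ≤ 1 := by
  have hmem : ∀ k, q k ∈ U.Dom := fun k => hq.2 ▸ Set.mem_range_self k
  have hud : InformationTheory.UniquelyDecodable ((F.image q : Finset (List Bool)) :
      Set (List Bool)) := by
    refine uniquelyDecodable_of_prefixFree (fun p hp p' hp' h => ?_) fun h => ?_
    · simp only [Finset.coe_image, Set.mem_image] at hp hp'
      obtain ⟨i, -, rfl⟩ := hp
      obtain ⟨j, -, rfl⟩ := hp'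
      exact hU.prefixFree _ (hmem i) _ (hmem j) h
    · simp only [Finset.coe_image, Set.mem_image] at h
      obtain ⟨i, -, hi⟩ := h
      simpa [hi] using hq.one_le_length hU i
  have h := InformationTheory.kraft_mcmillan_inequality hud
  rw [Finset.sum_image hq.1.injOn] at h
  simpa using h

/-! ### The entropy of finite sets of programs -/

/-- The statistical mechanical entropy of the programs with indices in `F`, where `l` gives the
lengths of the programs, `τ` is the inverse temperature and `β = 2 ^ (-τ)`. -/
noncomputable def finEntropy (l : ℕ → ℕ) (τ β : ℝ) (F : Finset ℕ) : ℝ :=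
  τ * ((∑ i ∈ F, (l i : ℝ) * β ^ l i) / ∑ i ∈ F, β ^ l i) + Real.logb 2 (∑ i ∈ F, β ^ l i)

section Entropy

variable {l : ℕ → ℕ} {τ β : ℝ}

theorem sum_pow_pos (hβ : 0 < β) {F : Finset ℕ} (hF : F.Nonempty) : 0 < ∑ i ∈ F, β ^ l i :=
  Finset.sum_pos (fun _ _ => by positivity) hF

/-- A program of length `L` and weight `w` moves the mean energy `e` by `(L - e) * w / (w + z)`, and
`L - e ≥ L / 2` when `L ≥ 2 * e`. The logarithm grows as well. -/
theorem finEntropy_insert (hτ : 0 < τ) (hβ : 0 < β) {F : Finset ℕ} (hF : F.Nonempty) {i : ℕ}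
    (hi : i ∉ F) {Z : ℝ} (hZ : ∑ k ∈ insert i F, β ^ l k ≤ Z)
    (hl : 2 * ((∑ k ∈ F, (l k : ℝ) * β ^ l k) / ∑ k ∈ F, β ^ l k) ≤ l i) :
    finEntropy l τ β F + τ / (2 * Z) * (l i * β ^ l i) ≤ finEntropy l τ β (insert i F) := by
  have hz := sum_pow_pos (l := l) hβ hF
  simp only [finEntropy]
  rw [Finset.sum_insert hi] at hZ ⊢
  rw [Finset.sum_insert hi]
  set z := ∑ k ∈ F, β ^ l k
  set A := ∑ k ∈ F, (l k : ℝ) * β ^ l k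
  have hw : 0 < β ^ l i := by positivity
  set w := β ^ l i
  have hlog : Real.logb 2 z ≤ Real.logb 2 (w + z) :=
    Real.logb_le_logb_of_le one_lt_two hz (by linarith)
  have hl0 : (0 : ℝ) ≤ l i := Nat.cast_nonneg _
  set L : ℝ := (l i : ℝ)
  have key : A / z + 1 / (2 * Z) * (L * w) ≤ (L * w + A) / (w + z) := by
    have hA : A = A / z * z := by field_simp
    set e := A / z
    have h1 : (L * w + A) / (w + z) - e = (L - e) * w / (w + z) := by
      rw [hA]; field_simp; ring
    have h2 : 1 / (2 * Z) * (L * w) ≤ (L - e) * w / (w + z) := by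
      rw [one_div, ← div_eq_inv_mul, div_le_div_iff₀ (by linarith) (by linarith)]
      have h3 : L / 2 ≤ L - e := by linarith
      calc L * w * (w + z) ≤ L * w * Z := by gcongr
        _ = (L / 2) * w * (2 * Z) := by ring
        _ ≤ (L - e) * w * (2 * Z) := by gcongr; linarith
    linarith
  have := mul_le_mul_of_nonneg_left key hτ.le
  calc _ = τ * (A / z + 1 / (2 * Z) * (L * w)) + Real.logb 2 z := by ring
    _ ≤ _ := add_le_add this hlog

/-- Enlarging the denominators only helps, `log (1 + t) ≤ t`, and lengths at least one let the
energy tail dominate the tail of the partition function. -/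
theorem finEntropy_sub_le (hτ : 0 < τ) (hβ : 0 < β) (hl : ∀ i, 1 ≤ l i) {F F' : Finset ℕ}
    (hFF' : F ⊆ F') {z : ℝ} (hz : 0 < z) (hzF : z ≤ ∑ i ∈ F, β ^ l i) :
    finEntropy l τ β F' - finEntropy l τ β F ≤
      (τ + 1 / Real.log 2) / z * ∑ i ∈ F' \ F, (l i : ℝ) * β ^ l i := by
  have hA := Finset.sum_sdiff (f := fun i => (l i : ℝ) * β ^ l i) hFF'
  have hZ := Finset.sum_sdiff (f := fun i => β ^ l i) hFF'
  have hBR : ∑ i ∈ F' \ F, β ^ l i ≤ ∑ i ∈ F' \ F, (l i : ℝ) * β ^ l i :=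
    Finset.sum_le_sum fun i _ =>
      le_mul_of_one_le_left (by positivity) (by exact_mod_cast hl i)
  have hR0 : 0 ≤ ∑ i ∈ F' \ F, β ^ l i := Finset.sum_nonneg fun _ _ => by positivity
  have hA0 : 0 ≤ ∑ i ∈ F, (l i : ℝ) * β ^ l i := Finset.sum_nonneg fun _ _ => by positivity
  simp only [finEntropy]
  rw [← hA, ← hZ]
  set B := ∑ i ∈ F' \ F, (l i : ℝ) * β ^ l i
  set R := ∑ i ∈ F' \ F, β ^ l i
  set A := ∑ i ∈ F, (l i : ℝ) * β ^ l i
  set Z := ∑ i ∈ F, β ^ l i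
  have hZ0 : 0 < Z := hz.trans_le hzF
  have hB0 : 0 ≤ B := hR0.trans hBR
  have h1 : (B + A) / (R + Z) ≤ B / z + A / Z := by
    rw [add_div]
    gcongr <;> linarith
  have hlog2 : 0 < Real.log 2 := Real.log_pos one_lt_two
  have h2 : Real.logb 2 (R + Z) - Real.logb 2 Z ≤ 1 / Real.log 2 * (B / z) := by
    rw [← Real.logb_div (by positivity) hZ0.ne', Real.logb, div_eq_inv_mul, ← one_div]
    refine mul_le_mul_of_nonneg_left ?_ (by positivity)
    refine (Real.log_le_sub_one_of_pos (by positivity)).trans ?_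
    rw [add_div, div_self hZ0.ne', add_sub_cancel_right]
    gcongr
  have h3 := mul_le_mul_of_nonneg_left h1 hτ.le
  calc _ ≤ τ * (B / z + A / Z) + Real.logb 2 (R + Z) - (τ * (A / Z) + Real.logb 2 Z) := by
        linarith
    _ ≤ τ * (B / z) + 1 / Real.log 2 * (B / z) := by linarith
    _ = _ := by ring

/-- The terms of the convergent Kraft sum tend to zero along the cofinite filter. -/
theorem exists_finite_length_lt (hk : ∀ F : Finset ℕ, ∑ i ∈ F, (1 / 2 : ℝ) ^ l i ≤ 1) (L : ℕ) :
    ∃ F : Finset ℕ, ∀ i ∉ F, L ≤ l i := by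
  have hs : Summable fun i => (1 / 2 : ℝ) ^ l i :=
    summable_of_sum_le (fun _ => by positivity) hk
  have h := hs.tendsto_cofinite_zero.eventually_lt_const
    (show (0 : ℝ) < (1 / 2) ^ L by positivity)
  rw [Filter.eventually_cofinite] at h
  refine ⟨h.toFinset, fun i hi => ?_⟩
  simp only [Set.Finite.mem_toFinset, Set.mem_ofPred_eq, not_not] at hi
  exact ((pow_lt_pow_iff_right_of_lt_one₀ (by norm_num) (by norm_num)).1 hi).le

/-- The limit of the entropies of finite sets, with estimates for the speed of convergence. -/
theorem exists_finEntropy_limit (hτ : 0 < τ) (hβ : 0 < β) (hl : ∀ i, 1 ≤ l i)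
    (hk : ∀ F : Finset ℕ, ∑ i ∈ F, (1 / 2 : ℝ) ^ l i ≤ 1)
    (hs : Summable fun i => (l i : ℝ) * β ^ l i) :
    ∃ (S κ C : ℝ) (F₀ : Finset ℕ), 0 < κ ∧ 0 < C ∧ F₀.Nonempty ∧
      Tendsto (finEntropy l τ β) atTop (𝓝 S) ∧
      ∀ F, F₀ ⊆ F → finEntropy l τ β F ≤ S ∧
        (∀ i ∉ F, κ * (l i * β ^ l i) ≤ S - finEntropy l τ β F) ∧
        ∀ B, (∀ F', F ⊆ F' → ∑ i ∈ F' \ F, (l i : ℝ) * β ^ l i ≤ B) →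
          S - finEntropy l τ β F ≤ C * B := by
  have hs' : Summable fun i => β ^ l i :=
    hs.of_nonneg_of_le (fun _ => by positivity) fun i =>
      le_mul_of_one_le_left (by positivity) (by exact_mod_cast hl i)
  set A := ∑' i, (l i : ℝ) * β ^ l i with hA
  set Z := ∑' i, β ^ l i with hZ
  have hAF : ∀ F : Finset ℕ, ∑ i ∈ F, (l i : ℝ) * β ^ l i ≤ A :=
    fun F => hs.sum_le_tsum F fun _ _ => by positivity
  have hZF : ∀ F : Finset ℕ, ∑ i ∈ F, β ^ l i ≤ Z :=
    fun F => hs'.sum_le_tsum F fun _ _ => by positivity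
  have hz0 : 0 < β ^ l 0 := by positivity
  have hZ0 : 0 < Z := hz0.trans_le (by simpa using hZF {0})
  -- A set containing index `0` has mean energy at most `A / β ^ l 0`. So, once `F₁` is included,
  -- every further program meets the length condition of `finEntropy_insert`.
  obtain ⟨L, hL⟩ := exists_nat_ge (2 * (A / β ^ l 0))
  obtain ⟨F₁, hF₁⟩ := exists_finite_length_lt hk L
  have hzF : ∀ F, insert 0 F₁ ⊆ F → β ^ l 0 ≤ ∑ i ∈ F, β ^ l i := fun F hF =>
    Finset.single_le_sum (f := fun i => β ^ l i) (fun _ _ => by positivity)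
      (hF (Finset.mem_insert_self _ _))
  have hne : ∀ F, insert 0 F₁ ⊆ F → F.Nonempty := fun F hF => ⟨0, hF (Finset.mem_insert_self _ _)⟩
  have hstep : ∀ F, insert 0 F₁ ⊆ F → ∀ i ∉ F, finEntropy l τ β F +
      τ / (2 * Z) * (l i * β ^ l i) ≤ finEntropy l τ β (insert i F) := by
    intro F hF i hi
    refine finEntropy_insert hτ hβ (hne F hF) hi (hZF _) ?_
    have h1 : (L : ℝ) ≤ l i := by
      exact_mod_cast hF₁ i fun h => hi (hF (Finset.mem_insert_of_mem h))
    refine le_trans ?_ (hL.trans h1)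
    have hA0 : 0 ≤ ∑ k ∈ F, (l k : ℝ) * β ^ l k := Finset.sum_nonneg fun _ _ => by positivity
    exact mul_le_mul_of_nonneg_left
      (div_le_div₀ (hA0.trans (hAF F)) (hAF F) hz0 (hzF F hF)) two_pos.le
  have hmono : ∀ F, insert 0 F₁ ⊆ F → ∀ G, finEntropy l τ β F ≤ finEntropy l τ β (G ∪ F) := by
    intro F hF G
    induction G using Finset.induction_on with
    | empty => simp
    | insert i G hi ih =>
      rw [Finset.insert_union]
      by_cases h : i ∈ G ∪ F
      · rwa [Finset.insert_eq_self.2 h]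
      · refine ih.trans (le_trans ?_ (hstep _ (hF.trans Finset.subset_union_right) i h))
        exact le_add_of_nonneg_right (by positivity)
  have hlim : Tendsto (finEntropy l τ β) atTop (𝓝 (τ * (A / Z) + Real.logb 2 Z)) :=
    ((hs.hasSum.div hs'.hasSum hZ0.ne').const_mul τ).add
      ((Real.continuousAt_logb hZ0.ne').tendsto.comp hs'.hasSum)
  have hle : ∀ F, insert 0 F₁ ⊆ F → finEntropy l τ β F ≤ τ * (A / Z) + Real.logb 2 Z := by
    intro F hF
    refine ge_of_tendsto hlim ?_
    filter_upwards [eventually_ge_atTop F] with F' hF'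
    simpa [Finset.union_eq_left.2 hF'] using hmono F hF F'
  have hlog2 : 0 < Real.log 2 := Real.log_pos one_lt_two
  refine ⟨τ * (A / Z) + Real.logb 2 Z, τ / (2 * Z), (τ + 1 / Real.log 2) / β ^ l 0, insert 0 F₁,
    by positivity, by positivity, ⟨0, Finset.mem_insert_self _ _⟩, hlim, fun F hF =>
    ⟨hle F hF, fun i hi => ?_, fun B hB => ?_⟩⟩
  · have := hle (insert i F) (hF.trans (Finset.subset_insert _ _))
    linarith [hstep F hF i hi]
  · refine le_of_tendsto (hlim.sub_const _) ?_
    filter_upwards [eventually_ge_atTop F] with F' hF'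
    refine (finEntropy_sub_le hτ hβ hl hF' hz0 (hzF F hF)).trans ?_
    exact mul_le_mul_of_nonneg_left (hB F' hF') (by positivity)

end Entropy

theorem two_rpow_neg_div (n : ℕ) (T : ℝ) :
    (2 : ℝ) ^ (-(n : ℝ) / T) = ((2 : ℝ) ^ (-(1 / T))) ^ n := by
  rw [← Real.rpow_natCast, ← Real.rpow_mul (by norm_num)]
  congr 1; ring

theorem entropyFn_eq_finEntropy (q : ℕ → List Bool) (n : ℕ) (T : ℝ) :
    entropyFn q n T = finEntropy (fun i => (q i).length) (1 / T) (2 ^ (-(1 / T)))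
      (Finset.range n) := by
  simp only [entropyFn, energyFn, partitionFn, finEntropy, two_rpow_neg_div]
  ring

/-! ### Divergence at high temperature -/

theorem exists_mul_pow_le {a b : ℝ} (ha : 0 < a) (hab : a < b) :
    ∃ C : ℝ, 0 < C ∧ ∀ n : ℕ, (n : ℝ) * a ^ n ≤ C * b ^ n := by
  have hb : 0 < b := ha.trans hab
  have h := tendsto_self_mul_const_pow_of_lt_one (r := a / b) (by positivity)
    ((div_lt_one hb).2 hab)
  obtain ⟨C, hC⟩ := h.bddAbove_range
  refine ⟨max C 1, by positivity, fun n => ?_⟩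
  have h1 := (hC ⟨n, rfl⟩).trans (le_max_left C 1)
  dsimp only at h1
  rwa [div_pow, ← mul_div_assoc, div_le_iff₀ (by positivity)] at h1

/-- This turns an upper bound on the length of a program into a lower bound on its term `l *
2^(-l)`. -/
theorem mul_half_pow_anti {m n : ℕ} (hm : 1 ≤ m) (hmn : m ≤ n) :
    (n : ℝ) * (1 / 2) ^ n ≤ m * (1 / 2) ^ m := by
  induction n, hmn using Nat.le_induction with
  | base => exact le_rfl
  | succ k hk ih =>
    refine le_trans ?_ ih
    have h1 : (1 : ℝ) ≤ k := by exact_mod_cast hm.trans hk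
    rw [pow_succ]
    push_cast
    nlinarith [show (0 : ℝ) < (1 / 2) ^ k by positivity]

/-- The `2^(2^j)` strings `1^j 0 w` with `|w| = 2^j` have distinct programs of length at most `j + 1
+ 2^j + c`. Each term is at least `2^j * 2^(-(j + 1 + 2^j + c))`, so every `j` contributes at least
`2^(-(1 + c))`. -/
theorem IsEnumeration.not_summable {U : List Bool →. List Bool} (hU : IsOptimal U)
    {q : ℕ → List Bool} (hq : IsEnumeration q U) :
    ¬ Summable fun i => ((q i).length : ℝ) * (1 / 2) ^ (q i).length := by
  intro hs
  obtain ⟨c, hc⟩ := hU.exists_program_selfDelimiting (φ := fun j => 2 ^ j)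
    ((Computable.const 2).natPow Computable.id)
  let word : (Σ j : ℕ, (Fin (2 ^ j) → Bool)) → List Bool :=
    fun σ => List.replicate σ.1 true ++ false :: List.ofFn σ.2
  have hword : Function.Injective word := by
    rintro ⟨j, v⟩ ⟨j', v'⟩ h
    have hj : j = j' := by
      rw [← idxOf_false_replicate j (List.ofFn v), ← idxOf_false_replicate j' (List.ofFn v')]
      exact congrArg _ h
    subst hj
    have h2 : List.ofFn v = List.ofFn v' := by simpa [word] using h
    rw [List.ofFn_injective h2]
  have hex : ∀ σ, ∃ k, word σ ∈ U (q k) ∧ (q k).length ≤ (word σ).length + c := fun σ => by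
    obtain ⟨p, hp, hl⟩ := hc (word σ) (replicate_append_mem_selfDelimiting (by simp))
    obtain ⟨k, rfl⟩ : p ∈ Set.range q := hq.2 ▸ (PFun.mem_dom _ _).2 ⟨_, hp⟩
    exact ⟨k, hp, hl⟩
  choose k hk hkl using hex
  have hkinj : Function.Injective k := fun σ σ' h =>
    hword (Part.mem_unique (hk σ) (h ▸ hk σ'))
  have h1 := hs.comp_injective hkinj
  have h2 : Summable fun σ : (Σ j : ℕ, (Fin (2 ^ j) → Bool)) =>
      (2 : ℝ) ^ σ.1 * (1 / 2) ^ (σ.1 + 1 + 2 ^ σ.1 + c) := by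
    refine h1.of_nonneg_of_le (fun _ => by positivity) fun σ => ?_
    have hlen : (word σ).length = σ.1 + 1 + 2 ^ σ.1 := by simp [word]; ring
    refine le_trans ?_ (mul_half_pow_anti (hq.one_le_length hU.1 (k σ)) (hlen ▸ hkl σ))
    refine mul_le_mul_of_nonneg_right ?_ (by positivity)
    have : 2 ^ σ.1 ≤ σ.1 + 1 + 2 ^ σ.1 + c := by omega
    exact_mod_cast this
  have h3 := h2.sigma
  have h4 : (fun j : ℕ => ∑' v : Fin (2 ^ j) → Bool,
      (2 : ℝ) ^ j * (1 / 2) ^ (j + 1 + 2 ^ j + c)) = fun _ => (1 / 2) ^ (1 + c) := by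
    funext j
    rw [tsum_fintype, Finset.sum_const, Finset.card_univ, Fintype.card_fun, Fintype.card_bool,
      Fintype.card_fin, nsmul_eq_mul, pow_add, pow_add, pow_add, pow_add]
    push_cast
    have hm : ∀ n : ℕ, (2 : ℝ) ^ n * (1 / 2) ^ n = 1 := fun n => by rw [← mul_pow]; norm_num
    linear_combination ((1 / 2 : ℝ) ^ 1 * (1 / 2) ^ c * ((2 : ℝ) ^ j * (1 / 2) ^ j)) * hm (2 ^ j) +
      (1 / 2 : ℝ) ^ 1 * (1 / 2) ^ c * hm j
  simp only at h3
  rw [h4, summable_const_iff] at h3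
  exact absurd h3 (by positivity)

/-- At `T = 1` the energy diverges because `Z ≤ 1`, while `log₂ Z` stays bounded below. For `T > 1`
the comparison `l * 2^(-l) ≤ C * β^l` makes `Z` itself diverge, and the energy is nonnegative. -/
theorem tendsto_entropyFn_atTop {U : List Bool →. List Bool} (hU : IsOptimal U)
    {q : ℕ → List Bool} (hq : IsEnumeration q U) {T : ℝ} (hT : 1 ≤ T) :
    Tendsto (fun n => entropyFn q n T) atTop atTop := by
  have hns := hq.not_summable hU
  simp only [entropyFn_eq_finEntropy]
  rcases hT.eq_or_lt with rfl | hT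
  · have hβ : (2 : ℝ) ^ (-(1 / 1 : ℝ)) = 1 / 2 := by
      rw [div_one, Real.rpow_neg_one]; norm_num
    rw [hβ]
    have h1 := (not_summable_iff_tendsto_nat_atTop_of_nonneg fun _ => by positivity).1 hns
    refine tendsto_atTop_mono' _ ?_
      (tendsto_atTop_add_const_right _ (Real.logb 2 ((1 / 2) ^ (q 0).length)) h1)
    filter_upwards [eventually_ge_atTop 1] with n hn
    have hz : (1 / 2 : ℝ) ^ (q 0).length ≤ ∑ i ∈ Finset.range n, (1 / 2 : ℝ) ^ (q i).length :=
      Finset.single_le_sum (f := fun i => (1 / 2 : ℝ) ^ (q i).length) (fun _ _ => by positivity)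
        (Finset.mem_range.2 hn)
    have hz0 : (0 : ℝ) < (1 / 2) ^ (q 0).length := by positivity
    refine add_le_add ?_ (Real.logb_le_logb_of_le one_lt_two hz0 hz)
    rw [div_one, one_mul]
    exact le_div_self (Finset.sum_nonneg fun _ _ => by positivity) (hz0.trans_le hz)
      (hq.kraft hU.1 _)
  · have hT0 : 0 < T := by linarith
    have hβ : (1 / 2 : ℝ) < 2 ^ (-(1 / T)) := by
      rw [one_div, ← Real.rpow_neg_one]
      refine Real.rpow_lt_rpow_of_exponent_lt one_lt_two ?_
      rw [neg_lt_neg_iff]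
      exact (div_lt_one hT0).2 hT
    set β : ℝ := 2 ^ (-(1 / T))
    obtain ⟨C, hC, h⟩ := exists_mul_pow_le (by norm_num) hβ
    have hns' : ¬ Summable fun i => β ^ (q i).length := fun hs =>
      hns ((hs.mul_left C).of_nonneg_of_le (fun _ => by positivity) fun i => h _)
    have h1 := (not_summable_iff_tendsto_nat_atTop_of_nonneg fun _ => by positivity).1 hns'
    refine tendsto_atTop_mono (fun n => ?_) ((Real.tendsto_logb_atTop one_lt_two).comp h1)
    refine le_add_of_nonneg_left (mul_nonneg (by positivity) (div_nonneg ?_ ?_)) <;>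
    exact Finset.sum_nonneg fun _ _ => by positivity

/-! ### Low temperature -/

theorem Computable.natFloor {α : Type*} [Primcodable α] {f : α → ℚ}
    (hf : IsCompRat f) : Computable fun a => ⌊f a⌋₊ := by
  obtain ⟨m, d, hm, hd, h⟩ := (hf.max (IsCompRat.const 0)).exists_nat_of_nonneg
    fun a => le_max_right _ _
  refine (hm.natDiv (hd.natAdd (Computable.const 1))).of_eq fun a => ?_
  have h1 : ⌊max (f a) 0⌋₊ = ⌊f a⌋₊ := by
    rcases le_total (f a) 0 with h0 | h0
    · rw [max_eq_right h0, Nat.floor_of_nonpos h0, Nat.floor_zero]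
    · rw [max_eq_left h0]
  rw [← h1, h a, ← Nat.floor_div_eq_div (K := ℚ)]
  push_cast
  rfl

/-- Starting at a stage `s₀` that already contains `F₀` costs only a constant and makes the entropy
estimates valid at every stage. -/
theorem IsEnumeration.exists_recursive_stages {U : List Bool →. List Bool} (hU : Partrec U)
    {q : ℕ → List Bool} (hq : IsEnumeration q U) (F₀ : Finset ℕ) :
    ∃ (E : ℕ → Finset ℕ) (bound : ℕ → ℕ), Computable bound ∧ Tendsto E atTop atTop ∧
      (∀ s, F₀ ⊆ E s) ∧
      (∀ f : ℕ → ℝ, IsCompReal f → IsCompReal fun s => ∑ k ∈ E s, f (q k).length) ∧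
      (∀ f : ℕ → ℚ, IsCompRat f → IsCompRat fun s => ∑ k ∈ E s, f (q k).length) ∧
      ∀ s, ∀ k ∈ E s, ∀ x ∈ U (q k), x.length < bound s := by
  obtain ⟨halt, len, bound, E, hh, hlen, hb, hmono, hex, hsum, hbound⟩ := hq.exists_stages hU
  have ht : Tendsto E atTop atTop := tendsto_atTop_finset_of_monotone hmono hex
  obtain ⟨s₀, hs₀⟩ := (ht.eventually_ge_atTop F₀).exists
  have hadd : Computable fun s => s + s₀ := Computable.id.natAdd (Computable.const s₀)
  have hh' : Computable fun p : ℕ × ℕ => halt (p.1 + s₀) p.2 :=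
    hh.comp ((hadd.comp Computable.fst).pair Computable.snd)
  refine ⟨fun s => E (s + s₀), fun s => bound (s + s₀), hb.comp hadd,
    ht.comp (tendsto_add_atTop_nat s₀), fun s => hs₀.trans (hmono (Nat.le_add_left _ _)),
    fun f hf => ?_, fun f hf => ?_, fun s => hbound _⟩
  · simp only [hsum]
    exact IsCompReal.sumRange (F := fun s i => if halt (s + s₀) i = true then f (len i) else 0)
      (IsCompReal.cond hh' (hf.comp (hlen.comp Computable.snd))
        (by simpa using IsCompReal.natCast (Computable.const 0))) hadd
  · have hsum' : ∀ s, ∑ k ∈ E s, f (q k).length =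
        ∑ i ∈ Finset.range s, if halt s i = true then f (len i) else 0 := fun s => by
      have := hsum s fun n => (f n : ℝ)
      rw [← Rat.cast_inj (α := ℝ)]
      simp only [Rat.cast_sum, apply_ite (Rat.cast : ℚ → ℝ), Rat.cast_zero]
      exact this
    simp only [hsum']
    exact IsCompRat.sumRange (F := fun s i => if halt (s + s₀) i = true then f (len i) else 0)
      (IsCompRat.cond hh' (hf.comp (hlen.comp Computable.snd)) (IsCompRat.const 0)) hadd

/-- The index `i` common to all stages bounds the partition function away from zero uniformly, as
inversion and logarithm require. -/
theorem isCompReal_finEntropy {l : ℕ → ℕ} {T : ℝ} (hT0 : 0 < T) (hT : IsComputableReal T)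
    {E : ℕ → Finset ℕ}
    (hE : ∀ f : ℕ → ℝ, IsCompReal f → IsCompReal fun s => ∑ k ∈ E s, f (l k))
    {i : ℕ} (hi : ∀ s, i ∈ E s) :
    IsCompReal fun s => finEntropy l (1 / T) (2 ^ (-(1 / T))) (E s) := by
  obtain ⟨δ, hδ0, hδ⟩ := exists_rat_btwn hT0
  have hτ : ∀ {α : Type} [Primcodable α], IsCompReal fun _ : α => 1 / T := fun {α} _ => by
    simp only [one_div]
    exact (IsCompReal.of_isComputableReal hT).inv (by exact_mod_cast hδ0) fun _ => hδ.le
  have hβ : IsCompReal fun _ : ℕ => (2 : ℝ) ^ (-(1 / T)) := hτ.two_rpow_neg fun _ => by positivity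
  set β : ℝ := 2 ^ (-(1 / T))
  have hβ0 : 0 < β := by positivity
  have hp : IsCompReal fun n : ℕ => β ^ n := hβ.pow (fun _ => hβ0.le) Computable.id
  have hZ := hE _ hp
  have hA := hE _ ((IsCompReal.natCast Computable.id).mul hp (fun _ => by positivity)
    fun _ => by positivity)
  obtain ⟨ε, hε0, hε⟩ := exists_rat_btwn (show 0 < β ^ l i by positivity)
  have hεZ : ∀ s, (ε : ℝ) ≤ ∑ k ∈ E s, β ^ l k := fun s => hε.le.trans
    (Finset.single_le_sum (f := fun k => β ^ l k) (fun _ _ => by positivity) (hi s))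
  have hε0' : 0 < ε := by exact_mod_cast hε0
  have hA0 : ∀ s, 0 ≤ ∑ k ∈ E s, (l k : ℝ) * β ^ l k := fun s =>
    Finset.sum_nonneg fun _ _ => by positivity
  have hZ0 : ∀ s, 0 ≤ (∑ k ∈ E s, β ^ l k)⁻¹ := fun s =>
    inv_nonneg.2 (Finset.sum_nonneg fun _ _ => by positivity)
  simp only [finEntropy, div_eq_mul_inv (∑ k ∈ E _, (l k : ℝ) * β ^ l k)]
  exact (hτ.mul (hA.mul (hZ.inv hε0' hεZ) hA0 hZ0) (fun _ => by positivity)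
    fun s => mul_nonneg (hA0 s) (hZ0 s)).add (hZ.logb hε0' hεZ)

theorem isLeftComputable_of_approx {S : ℝ} {e : ℕ → ℝ} {G : ℕ → ℚ} (hG : IsCompRat G)
    (hGe : ∀ s, |(G s : ℝ) - e s| ≤ (1 / 2) ^ s) (he : ∀ s, e s ≤ S)
    (hlim : Tendsto (fun s => (G s : ℝ) - (1 / 2) ^ s) atTop (𝓝 S)) : IsLeftComputable S := by
  refine ⟨fun s => -(G s - (1 / 2) ^ s),
    ((hG.sub ((IsCompRat.const (1 / 2)).pow Computable.id)).neg).isRecursiveRat, fun s _ => ?_, ?_⟩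
  · push_cast
    linarith [(abs_le.1 (hGe s)).2, he s]
  · push_cast
    exact hlim.neg

/-! ### Chaitin randomness of the entropy -/

theorem natFloor_fract_lt (S : ℝ) (n : ℕ) : ⌊Int.fract S * 2 ^ n⌋₊ < 2 ^ n := by
  rw [Nat.floor_lt (mul_nonneg (Int.fract_nonneg S) (by positivity))]
  push_cast
  exact mul_lt_of_lt_one_left (by positivity) (Int.fract_lt_one S)

theorem isChaitinRandom_of_approx {U : List Bool →. List Bool} (hU : IsOptimal U)
    {q : ℕ → List Bool} (hq : IsEnumeration q U) {T : ℝ} (hT0 : 0 < T)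
    {S κ : ℝ} (hκ : 0 < κ) {e : ℕ → ℝ} {G : ℕ → ℚ} (hG : IsCompRat G)
    (hGe : ∀ s, |(G s : ℝ) - e s| ≤ (1 / 2) ^ s)
    (hlim : Tendsto (fun s => (G s : ℝ) - (1 / 2) ^ s) atTop (𝓝 S))
    {E : ℕ → Finset ℕ} {bound : ℕ → ℕ} (hb : Computable bound)
    (hbound : ∀ s, ∀ k ∈ E s, ∀ x ∈ U (q k), x.length < bound s)
    (hrem : ∀ s, ∀ k ∉ E s, κ * ((q k).length * ((2 : ℝ) ^ (-(1 / T))) ^ (q k).length) ≤ S - e s) :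
    IsChaitinRandom U T (binaryExpansion S) := by
  -- The integer part is a constant of the machine. Subtracting one unit in the last place puts the
  -- value strictly below `S` even for dyadic `S`, so the search for a larger approximation halts.
  let val : List Bool → ℚ := fun v =>
    (⌊S⌋ : ℚ) + (bitsVal v : ℚ) * (1 / 2) ^ v.length - (1 / 2) ^ v.length
  have hval : IsCompRat val :=
    ((IsCompRat.const _).add ((IsCompRat.natCast computable_bitsVal).mul
      ((IsCompRat.const _).pow Computable.list_length))).sub
      ((IsCompRat.const _).pow Computable.list_length)
  have hp : Computable fun x : List Bool × ℕ => decide (val x.1 < G x.2 - (1 / 2) ^ x.2) :=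
    (hval.comp Computable.fst).decide_lt
      ((hG.sub ((IsCompRat.const (1 / 2)).pow Computable.id)).comp Computable.snd)
  obtain ⟨c, hc⟩ := hU.complexity_search_le (p := fun v s => decide (val v < G s - (1 / 2) ^ s)) hp
    (out := fun _ s => List.replicate (bound s) true)
    (computable_replicate_true.comp (hb.comp Computable.snd))
  -- The last inequality is `T` times the logarithm of `κ * L * 2^(-L / T) ≤ 2 * 2^(-n)`.
  have key : ∀ n : ℕ, ∃ L : ℕ, 1 ≤ L ∧
      L ≤ complexity U (bitPrefix (binaryExpansion S) n) + c ∧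
      T * n + T * (Real.logb 2 κ - 1) + T * Real.logb 2 L ≤ L := by
    intro n
    rw [bitPrefix_binaryExpansion]
    have hN := natFloor_fract_lt S n
    have hN1 : Int.fract S * 2 ^ n < ⌊Int.fract S * 2 ^ n⌋₊ + 1 := Nat.lt_floor_add_one _
    have hN2 : (⌊Int.fract S * 2 ^ n⌋₊ : ℝ) ≤ Int.fract S * 2 ^ n :=
      Nat.floor_le (mul_nonneg (Int.fract_nonneg S) (by positivity))
    set N := ⌊Int.fract S * 2 ^ n⌋₊
    have h2n : (2 : ℝ) ^ n * (1 / 2) ^ n = 1 := by rw [← mul_pow]; norm_num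
    have hhalf : (0 : ℝ) < (1 / 2) ^ n := by positivity
    have hv : ((val (toBits n N) : ℚ) : ℝ) = ⌊S⌋ + N * (1 / 2) ^ n - (1 / 2) ^ n := by
      simp only [val, bitsVal_toBits hN, length_toBits]
      push_cast
      rfl
    have hS := Int.floor_add_fract S
    have hle : (N : ℝ) * (1 / 2) ^ n ≤ Int.fract S := by
      have := mul_le_mul_of_nonneg_right hN2 hhalf.le
      rwa [mul_assoc, h2n, mul_one] at this
    have hlt : Int.fract S < (N : ℝ) * (1 / 2) ^ n + (1 / 2) ^ n := by
      have := mul_lt_mul_of_pos_right hN1 hhalf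
      rwa [mul_assoc, h2n, mul_one, add_mul, one_mul] at this
    have hex : ∃ s, decide (val (toBits n N) < G s - (1 / 2) ^ s) = true := by
      obtain ⟨s, hs⟩ := (hlim.eventually_const_lt
        (show ((val (toBits n N) : ℚ) : ℝ) < S by rw [hv]; linarith)).exists
      refine ⟨s, decide_eq_true ?_⟩
      have : ((val (toBits n N) : ℚ) : ℝ) < ((G s - (1 / 2) ^ s : ℚ) : ℝ) := by push_cast; exact hs
      exact_mod_cast this
    have hsc := hc _ hex
    have hs := Nat.sInf_mem (s := {s | decide (val (toBits n N) < G s - (1 / 2) ^ s) = true}) hex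
    set s := sInf {s | decide (val (toBits n N) < G s - (1 / 2) ^ s) = true}
    have hs' : ((val (toBits n N) : ℚ) : ℝ) < ((G s - (1 / 2) ^ s : ℚ) : ℝ) := by
      exact_mod_cast of_decide_eq_true hs
    push_cast at hs'
    rw [hv] at hs'
    have hSe : S - e s ≤ 2 * (1 / 2) ^ n := by linarith [(abs_le.1 (hGe s)).2]
    obtain ⟨p, hp, hpl⟩ := hU.exists_shortest_program (List.replicate (bound s) true)
    obtain ⟨k, rfl⟩ : p ∈ Set.range q := hq.2 ▸ (PFun.mem_dom _ _).2 ⟨_, hp⟩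
    -- Programs in `E s` have outputs shorter than `bound s`.
    have hk : k ∉ E s := fun hk => by simpa using hbound s k hk _ hp
    refine ⟨(q k).length, hq.one_le_length hU.1 k, hpl ▸ hsc, ?_⟩
    have h1 := (hrem s k hk).trans hSe
    have hl0 : (0 : ℝ) < (q k).length := by exact_mod_cast hq.one_le_length hU.1 k
    set L : ℝ := ((q k).length : ℝ) with hL
    rw [← two_rpow_neg_div] at h1
    have h2 := Real.logb_le_logb_of_le one_lt_two (by positivity) h1
    rw [Real.logb_mul hκ.ne' (by positivity), Real.logb_mul hl0.ne' (by positivity),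
      Real.logb_rpow (by norm_num) (by norm_num), Real.logb_mul (by norm_num) (by positivity),
      Real.logb_self_eq_one one_lt_two, one_div, inv_pow, Real.logb_inv,
      Real.logb_pow, Real.logb_self_eq_one one_lt_two] at h2
    have h3 := mul_le_mul_of_nonneg_left h2 hT0.le
    have h4 : T * (-L / T) = -L := by field_simp
    rw [← hL] at h3
    linarith
  choose L hL1 hL2 hL3 using key
  have hlin : Tendsto (fun n : ℕ => T * n + T * (Real.logb 2 κ - 1)) atTop atTop :=
    tendsto_atTop_add_const_right _ _ (tendsto_natCast_atTop_atTop.const_mul_atTop hT0)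
  -- First `L ≥ T * n + O(1)`, since `log₂ L ≥ 0`; putting this back into the logarithm gives an
  -- excess that tends to infinity.
  have hlog : Tendsto (fun n : ℕ => T * Real.logb 2 (T * n + T * (Real.logb 2 κ - 1)) +
      (T * (Real.logb 2 κ - 1) - c)) atTop atTop :=
    tendsto_atTop_add_const_right _ _
      (((Real.tendsto_logb_atTop one_lt_two).comp hlin).const_mul_atTop hT0)
  refine tendsto_atTop_mono' _ ?_ hlog
  filter_upwards [hlin.eventually_ge_atTop 1] with n hn
  have h1 : (1 : ℝ) ≤ L n := by exact_mod_cast hL1 n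
  have h2 : (L n : ℝ) ≤ complexity U (bitPrefix (binaryExpansion S) n) + c := by
    exact_mod_cast hL2 n
  have h3 := hL3 n
  have h4 := mul_nonneg hT0.le (Real.logb_nonneg one_lt_two h1)
  have h5 := mul_le_mul_of_nonneg_left (Real.logb_le_logb_of_le one_lt_two
    (show 0 < T * n + T * (Real.logb 2 κ - 1) by linarith)
    (show T * n + T * (Real.logb 2 κ - 1) ≤ L n by linarith)) hT0.le
  linarith

/-! ### Compressibility of the entropy -/

/-- `K * j` bits of `Ω` serve for about `M * j` bits of `S`; the extra `1` pays for the `j` ones of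
the self-delimiting header. -/
theorem exists_ratio_btwn_with_gap {T T' : ℝ} (hT0 : 0 < T) (hTT' : T < T') :
    ∃ M K : ℕ, 0 < M ∧ 0 < K ∧ T * M < K ∧ (K : ℝ) + 1 ≤ T' * M := by
  obtain ⟨M, hM⟩ := exists_nat_gt (2 / (T' - T))
  have hd : 0 < T' - T := sub_pos.2 hTT'
  have hM0 : (0 : ℝ) < M := lt_of_le_of_lt (by positivity) hM
  rw [div_lt_iff₀ hd] at hM
  refine ⟨M, ⌊T * M⌋₊ + 1, by exact_mod_cast hM0, by omega, ?_, ?_⟩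
  · push_cast
    exact Nat.lt_floor_add_one _
  · push_cast
    linarith [Nat.floor_le (show 0 ≤ T * M by positivity)]

/-- Estimate for the tail of the energy sum in terms of the tail of the halting probability. -/
theorem exists_tail_bound {l : ℕ → ℕ} {T : ℝ} (hT0 : 0 < T) {M K : ℕ} (hK : 0 < K)
    (hTM : T * M < K) (hKM : K ≤ M) :
    ∃ C : ℝ, 0 < C ∧ ∀ (j : ℕ) (F : Finset ℕ),
      ∑ i ∈ F, (1 / 2 : ℝ) ^ l i ≤ (1 / 2) ^ (K * j) →
      ∑ i ∈ F, (l i : ℝ) * ((2 : ℝ) ^ (-(1 / T))) ^ l i ≤ C * (1 / 2) ^ (M * j) := by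
  have hK0 : (0 : ℝ) < K := by exact_mod_cast hK
  have hKM' : (K : ℝ) ≤ M := by exact_mod_cast hKM
  -- Chosen so that `γ^K = 2^(-M)`. From `T < K / M` follows `β < γ`, which absorbs the factor `l`;
  -- from `K ≤ M` follows `2 * γ ≤ 1`.
  set γ : ℝ := 2 ^ (-((M : ℝ) / K)) with hγ
  have hγ0 : 0 < γ := by positivity
  have hβγ : (2 : ℝ) ^ (-(1 / T)) < γ := by
    refine Real.rpow_lt_rpow_of_exponent_lt one_lt_two (neg_lt_neg ?_)
    rw [div_lt_div_iff₀ hK0 hT0]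
    linarith
  have hγ1 : γ ≤ 1 / 2 := by
    rw [one_div, ← Real.rpow_neg_one]
    refine Real.rpow_le_rpow_of_exponent_le one_le_two (neg_le_neg ?_)
    rwa [le_div_iff₀ hK0, one_mul]
  have hγK : γ ^ K = (1 / 2) ^ M := by
    rw [hγ, ← Real.rpow_natCast, ← Real.rpow_mul (by norm_num), neg_mul,
      div_mul_cancel₀ _ hK0.ne', Real.rpow_neg (by norm_num), Real.rpow_natCast, one_div, inv_pow]
  obtain ⟨C, hC, h⟩ := exists_mul_pow_le (by positivity) hβγ
  refine ⟨C, hC, fun j F hF => ?_⟩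
  -- A single term is already bounded by `2^(-K * j)`.
  have hl : ∀ i ∈ F, K * j ≤ l i := fun i hi => by
    have h1 := (Finset.single_le_sum (f := fun i => (1 / 2 : ℝ) ^ l i)
      (fun _ _ => by positivity) hi).trans hF
    exact (pow_le_pow_iff_right_of_lt_one₀ (by norm_num) (by norm_num)).1 h1
  have h2 : ∀ n : ℕ, γ ^ n = (1 / 2) ^ n * (2 * γ) ^ n := fun n => by
    rw [← mul_pow]; congr 1; ring
  calc ∑ i ∈ F, (l i : ℝ) * ((2 : ℝ) ^ (-(1 / T))) ^ l i
      ≤ ∑ i ∈ F, C * ((1 / 2) ^ l i * (2 * γ) ^ (K * j)) := by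
        refine Finset.sum_le_sum fun i hi => (h (l i)).trans ?_
        rw [h2]
        refine mul_le_mul_of_nonneg_left (mul_le_mul_of_nonneg_left ?_ (by positivity)) hC.le
        exact pow_le_pow_of_le_one (by positivity) (by linarith) (hl i hi)
    _ = C * ((∑ i ∈ F, (1 / 2) ^ l i) * (2 * γ) ^ (K * j)) := by
        rw [← Finset.mul_sum, Finset.sum_mul]
    _ ≤ C * ((1 / 2) ^ (K * j) * (2 * γ) ^ (K * j)) := by gcongr
    _ = C * (1 / 2) ^ (M * j) := by rw [← h2, pow_mul, hγK, ← pow_mul]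

theorem exists_complexity_le_of_approx {U : List Bool →. List Bool} (hU : IsOptimal U)
    {q : ℕ → List Bool} (hq : IsEnumeration q U) {T T' : ℝ} (hT0 : 0 < T) (hTT' : T < T')
    (hT' : T' ≤ 1) {S C : ℝ} (hC : 0 < C) {e : ℕ → ℝ} {G : ℕ → ℚ} (hG : IsCompRat G)
    (hGe : ∀ s, |(G s : ℝ) - e s| ≤ (1 / 2) ^ s) {E : ℕ → Finset ℕ} (hE : Tendsto E atTop atTop)
    (hΩ : IsCompRat fun s => ∑ k ∈ E s, (1 / 2 : ℚ) ^ (q k).length) (heS : ∀ s, e s ≤ S)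
    (hrem : ∀ s B, (∀ F', E s ⊆ F' →
      ∑ i ∈ F' \ E s, ((q i).length : ℝ) * ((2 : ℝ) ^ (-(1 / T))) ^ (q i).length ≤ B) →
      S - e s ≤ C * B) :
    ∃ c : ℝ, ∀ n : ℕ, (complexity U (bitPrefix (binaryExpansion S) n) : ℝ) ≤ T' * n + c := by
  obtain ⟨M, K, hM, hK, hTM, hKT⟩ := exists_ratio_btwn_with_gap hT0 hTT'
  have hM0 : (0 : ℝ) < M := by exact_mod_cast hM
  have hKM : K ≤ M := by
    have : (K : ℝ) ≤ M := by nlinarith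
    exact_mod_cast this
  obtain ⟨C₁, hC₁, htail⟩ := exists_tail_bound (l := fun i => (q i).length) hT0 hK hTM hKM
  have hsumm : Summable fun i => (1 / 2 : ℝ) ^ (q i).length :=
    summable_of_sum_le (fun _ => by positivity) (hq.kraft hU.1)
  set Ω := ∑' i, (1 / 2 : ℝ) ^ (q i).length with hΩdef
  have hΩ1 : Ω ≤ 1 := hsumm.tsum_le_of_sum_le (hq.kraft hU.1)
  have hΩF : ∀ F : Finset ℕ, ∑ i ∈ F, (1 / 2 : ℝ) ^ (q i).length ≤ Ω :=
    fun F => hsumm.sum_le_tsum F fun _ _ => by positivity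
  have hΩ0 : 0 < Ω := lt_of_lt_of_le (by positivity) (hΩF {0})
  have hΩlim : Tendsto (fun s => ∑ k ∈ E s, (1 / 2 : ℝ) ^ (q k).length) atTop (𝓝 Ω) :=
    hsumm.hasSum.comp hE
  -- Error bound in units of `2^(-n)`: the tail estimate, with `2^M` covering the remainder `n % M`,
  -- plus one for the rational approximation.
  obtain ⟨D, hD⟩ := exists_nat_ge (C * C₁ * 2 ^ M + 1)
  let idx : List Bool → ℕ := fun v => v.idxOf false
  have hidx : Computable idx :=
    (Primrec.list_idxOf (α := Bool)).to_comp.comp (Computable.const false) Computable.id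
  let len : ℕ → List Bool → ℕ := fun r v => M * idx v + r
  have hlen : ∀ r, Computable (len r) := fun r =>
    ((Computable.const M).natMul hidx).natAdd (Computable.const r)
  let val : List Bool → ℚ := fun v =>
    (bitsVal (v.drop (idx v + 1)) : ℚ) * (1 / 2) ^ (K * idx v)
  have hval : IsCompRat val :=
    (IsCompRat.natCast (computable_bitsVal.comp (Primrec.list_drop.to_comp.comp
      (hidx.natAdd (Computable.const 1)) Computable.id))).mul
      ((IsCompRat.const _).pow ((Computable.const K).natMul hidx))
  -- The condition `len r v ≤ s` makes the error `2^(-s)` of `G s` at most `2^(-n)`.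
  let test : ℕ → List Bool → ℕ → Bool := fun r v s =>
    decide (len r v ≤ s) && decide (val v < ∑ k ∈ E s, (1 / 2 : ℚ) ^ (q k).length)
  have htest : ∀ r, Computable fun x : List Bool × ℕ => test r x.1 x.2 := fun r =>
    (((hlen r).comp Computable.fst).decideLE Computable.snd).boolAnd
      ((hval.comp Computable.fst).decide_lt (hΩ.comp Computable.snd))
  -- Adding `D` makes this an overestimate of `fract S * 2^n`, by at most `2 * D`, so only
  -- subtraction is needed as correction.
  let approx : ℕ → List Bool → ℕ → ℚ := fun r v s =>
    (G s - (⌊S⌋ : ℚ)) * 2 ^ len r v + (D : ℚ)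
  have happrox : ∀ r, IsCompRat fun x : List Bool × ℕ => approx r x.1 x.2 := fun r =>
    (((hG.comp Computable.snd).sub (IsCompRat.const _)).mul
      ((IsCompRat.const 2).pow ((hlen r).comp Computable.fst))).add (IsCompRat.const _)
  have hout : ∀ r t, Computable fun x : List Bool × ℕ =>
      toBits (len r x.1) (⌊approx r x.1 x.2⌋₊ - t) := fun r t =>
    computable_toBits.comp (((hlen r).comp Computable.fst).pair
      ((Computable.natFloor (happrox r)).natSub (Computable.const t)))
  choose c hc using fun r t => hU.complexity_search_le (htest r)
    (out := fun v s => toBits (len r v) (⌊approx r v s⌋₊ - t)) (hout r t)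
  obtain ⟨c₀, hc₀⟩ := hU.exists_program_selfDelimiting (φ := fun j => K * j)
    ((Computable.const K).natMul Computable.id)
  -- One machine for each remainder `r` and correction `t`; there are finitely many, so one constant
  -- serves all.
  set c₁ := (Finset.range M).sup fun r => (Finset.range (2 * D + 1)).sup fun t => c r t with hc₁
  have hc₁le : ∀ r < M, ∀ t < 2 * D + 1, c r t ≤ c₁ := fun r hr t ht =>
    (Finset.le_sup (f := fun t => c r t) (Finset.mem_range.2 ht)).trans
      (Finset.le_sup (f := fun r => (Finset.range (2 * D + 1)).sup fun t => c r t)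
        (Finset.mem_range.2 hr))
  refine ⟨1 + c₀ + c₁, fun n => ?_⟩
  set j := n / M with hj
  set r := n % M with hr
  have hrM : r < M := Nat.mod_lt _ hM
  have hn : M * j + r = n := Nat.div_add_mod n M
  set k := K * j with hk
  -- Rounding strictly down, even for dyadic `Ω`, ensures that some stage exceeds `b * 2^(-k)`.
  set b := ⌈Ω * 2 ^ k⌉₊ - 1 with hb
  have hceil : 0 < ⌈Ω * 2 ^ k⌉₊ := Nat.ceil_pos.2 (by positivity)
  have hb1 : (b : ℝ) < Ω * 2 ^ k := Nat.lt_ceil.1 (by omega)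
  have hb2 : Ω * 2 ^ k ≤ b + 1 := by
    have h1 := Nat.le_ceil (Ω * 2 ^ k)
    have h2 : ((b + 1 : ℕ) : ℝ) = (⌈Ω * 2 ^ k⌉₊ : ℝ) := by
      congr 1; omega
    push_cast at h2
    linarith
  have hbk : b < 2 ^ k := by
    have : (b : ℝ) < 2 ^ k := hb1.trans_le (mul_le_of_le_one_left (by positivity) hΩ1)
    exact_mod_cast this
  set v := List.replicate j true ++ false :: toBits k b with hv
  have hvidx : idx v = j := idxOf_false_replicate j _
  have hvlen : len r v = n := by simp only [len, hvidx, hn]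
  have hvdrop : v.drop (j + 1) = toBits k b := by
    rw [hv, List.drop_append]
    simp
  have h2k : (2 : ℝ) ^ k * (1 / 2) ^ k = 1 := by rw [← mul_pow]; norm_num
  have hvval : ((val v : ℚ) : ℝ) = b * (1 / 2) ^ k := by
    simp only [val, hvidx, hvdrop, bitsVal_toBits hbk]
    push_cast
    rfl
  have hhalfk : (0 : ℝ) < (1 / 2) ^ k := by positivity
  have hvΩ : ((val v : ℚ) : ℝ) < Ω := by
    have := mul_lt_mul_of_pos_right hb1 hhalfk
    rwa [mul_assoc, h2k, mul_one, ← hvval] at this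
  have hΩv : Ω ≤ (val v : ℚ) + (1 / 2) ^ k := by
    have := mul_le_mul_of_nonneg_right hb2 hhalfk.le
    rwa [mul_assoc, h2k, mul_one, add_mul, one_mul, ← hvval] at this
  have hex : ∃ s, test r v s = true := by
    obtain ⟨s, hs1, hs2⟩ := ((hΩlim.eventually_const_lt hvΩ).and (eventually_ge_atTop n)).exists
    refine ⟨s, ?_⟩
    simp only [test, Bool.and_eq_true, decide_eq_true_eq, hvlen]
    refine ⟨hs2, ?_⟩
    rw [← Rat.cast_lt (K := ℝ)]
    push_cast
    exact hs1
  have hHv : complexity U v ≤ (K + 1) * j + 1 + c₀ := by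
    obtain ⟨p, hp, hpl⟩ := hc₀ v (replicate_append_mem_selfDelimiting (length_toBits k b))
    refine (complexity_le_length hp).trans (hpl.trans (le_of_eq ?_))
    simp [hv, hk]; ring
  have hfin : ∃ t < 2 * D + 1, complexity U (bitPrefix (binaryExpansion S) n) ≤
      complexity U v + c r t := by
    have hs := Nat.sInf_mem (s := {s | test r v s = true}) hex
    have hcs := fun t => hc r t v hex
    set s := sInf {s | test r v s = true}
    simp only [Set.mem_ofPred_eq, test, Bool.and_eq_true, decide_eq_true_eq, hvlen] at hs
    obtain ⟨hns, hs⟩ := hs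
    rw [← Rat.cast_lt (K := ℝ)] at hs
    push_cast at hs
    have hhalfn : (0 : ℝ) < (1 / 2) ^ n := by positivity
    have h2n : (1 / 2 : ℝ) ^ n * 2 ^ n = 1 := by rw [← mul_pow]; norm_num
    have hB := hrem s (C₁ * (1 / 2) ^ (M * j)) fun F' hF' => htail j _ (by
      have h1 := Finset.sum_sdiff (f := fun i => (1 / 2 : ℝ) ^ (q i).length) hF'
      have h2 := hΩF F'
      linarith)
    have hpow : (1 / 2 : ℝ) ^ (M * j) ≤ 2 ^ M * (1 / 2) ^ n := by
      rw [← hn, pow_add, mul_left_comm]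
      refine le_mul_of_one_le_right (by positivity) ?_
      calc (1 : ℝ) = 2 ^ r * (1 / 2) ^ r := by rw [← mul_pow]; norm_num
        _ ≤ 2 ^ M * (1 / 2) ^ r :=
          mul_le_mul_of_nonneg_right (pow_le_pow_right₀ one_le_two hrM.le) (by positivity)
    have hB' : S - e s ≤ (C * C₁ * 2 ^ M) * (1 / 2) ^ n := by
      refine hB.trans ?_
      calc C * (C₁ * (1 / 2) ^ (M * j)) ≤ C * (C₁ * (2 ^ M * (1 / 2) ^ n)) := by gcongr
        _ = _ := by ring
    have hGs := (hGe s).trans (pow_le_pow_of_le_one (by norm_num) (by norm_num) hns)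
    have hCC : 0 ≤ C * C₁ * 2 ^ M := by positivity
    have hup : (G s : ℝ) ≤ S + D * (1 / 2) ^ n := by
      have := (abs_le.1 hGs).2
      nlinarith [heS s]
    have hdn : S - D * (1 / 2) ^ n ≤ G s := by
      have := (abs_le.1 hGs).1
      nlinarith
    have hfl := Int.floor_add_fract S
    have hy : ((approx r v s : ℚ) : ℝ) = (G s - ⌊S⌋) * 2 ^ n + D := by
      simp only [approx, hvlen]
      push_cast
      rfl
    have hy1 : Int.fract S * 2 ^ n ≤ (approx r v s : ℚ) := by
      have := mul_le_mul_of_nonneg_right hdn (show (0 : ℝ) ≤ 2 ^ n by positivity)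
      rw [hy]
      linear_combination this + D * h2n + 2 ^ n * hfl
    have hy2 : ((approx r v s : ℚ) : ℝ) ≤ Int.fract S * 2 ^ n + (2 * D : ℕ) := by
      have := mul_le_mul_of_nonneg_right hup (show (0 : ℝ) ≤ 2 ^ n by positivity)
      rw [hy]
      push_cast
      linear_combination this + D * h2n - 2 ^ n * hfl
    have hf0 : 0 ≤ Int.fract S * 2 ^ n := mul_nonneg (Int.fract_nonneg S) (by positivity)
    have hfl1 := Nat.floor_le_floor hy1
    have hfl2 := Nat.floor_le_floor hy2
    rw [Nat.floor_add_natCast hf0] at hfl2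
    have hcast : ⌊((approx r v s : ℚ) : ℝ)⌋₊ = ⌊approx r v s⌋₊ := by
      rw [← Int.floor_toNat, Rat.floor_cast, Int.floor_toNat]
    rw [hcast] at hfl1 hfl2
    refine ⟨⌊approx r v s⌋₊ - ⌊Int.fract S * 2 ^ n⌋₊, by omega, ?_⟩
    refine le_trans (le_of_eq ?_) (hcs _)
    rw [bitPrefix_binaryExpansion, hvlen]
    congr 2
    omega
  obtain ⟨t, ht, hHt⟩ := hfin
  have h1 : complexity U (bitPrefix (binaryExpansion S) n) ≤ (K + 1) * j + 1 + c₀ + c₁ := by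
    have := hc₁le r hrM t ht
    omega
  have h2 : (complexity U (bitPrefix (binaryExpansion S) n) : ℝ) ≤
      (K + 1) * j + 1 + c₀ + c₁ := by exact_mod_cast h1
  have h3 : (n : ℝ) = M * j + r := by exact_mod_cast hn.symm
  have h4 : ((K : ℝ) + 1) * j ≤ T' * M * j := by gcongr
  have h5 : 0 ≤ T' * r := mul_nonneg (by linarith) (Nat.cast_nonneg _)
  rw [h3]
  linarith

/-- The positive part of `H(α_n) - T * n` serves as error term: a slope `T'` bounds it by `(T' - T)
* n + c`, and `T'` may approach `T`. -/
theorem isCompressible_of_forall {U : List Bool →. List Bool} {T : ℝ} (hT1 : T < 1)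
    {α : ℕ → Bool} (h : ∀ T', T < T' → T' ≤ 1 →
      ∃ c : ℝ, ∀ n : ℕ, (complexity U (bitPrefix α n) : ℝ) ≤ T' * n + c) :
    IsCompressible U T α := by
  refine ⟨fun n => max ((complexity U (bitPrefix α n) : ℝ) - T * n) 0, ?_, fun n _ => by
    linarith [le_max_left ((complexity U (bitPrefix α n) : ℝ) - T * n) 0]⟩
  rw [Metric.tendsto_atTop]
  intro ε hε
  obtain ⟨c, hc⟩ := h (min (T + ε / 2) 1) (lt_min (by linarith) hT1) (min_le_right _ _)
  obtain ⟨N, hN⟩ := exists_nat_gt (max (2 * c / ε) 0)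
  refine ⟨N, fun n hn => ?_⟩
  have hn' : max (2 * c / ε) 0 < n := hN.trans_le (by exact_mod_cast hn)
  have hn0 : (0 : ℝ) < n := (le_max_right _ _).trans_lt hn'
  have hnc := (le_max_left _ _).trans_lt hn'
  rw [div_lt_iff₀ hε] at hnc
  rw [Real.dist_eq, sub_zero, abs_of_nonneg (div_nonneg (le_max_right _ _) hn0.le),
    div_lt_iff₀ hn0]
  refine max_lt ?_ (by positivity)
  have h1 := mul_le_mul_of_nonneg_right (min_le_left (T + ε / 2) 1) hn0.le
  linarith [hc n]

theorem entropyFn_low_temperature {U : List Bool →. List Bool} (hU : IsOptimal U)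
    {q : ℕ → List Bool} (hq : IsEnumeration q U) {T : ℝ} (hT0 : 0 < T) (hT1 : T < 1)
    (hT : IsComputableReal T) :
    ∃ S : ℝ, Tendsto (fun n => entropyFn q n T) atTop (𝓝 S) ∧ IsLeftComputable S ∧
      IsChaitinRandom U T (binaryExpansion S) ∧ IsCompressible U T (binaryExpansion S) := by
  have hk := hq.kraft hU.1
  have hβ0 : (0 : ℝ) < 2 ^ (-(1 / T)) := by positivity
  have hβ : (2 : ℝ) ^ (-(1 / T)) < 1 / 2 := by
    rw [one_div 2, ← Real.rpow_neg_one]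
    refine Real.rpow_lt_rpow_of_exponent_lt one_lt_two (neg_lt_neg ?_)
    rwa [lt_div_iff₀ hT0, one_mul]
  have hs : Summable fun i => ((q i).length : ℝ) * (2 ^ (-(1 / T))) ^ (q i).length := by
    obtain ⟨C, -, h⟩ := exists_mul_pow_le hβ0 hβ
    exact ((summable_of_sum_le (fun _ => by positivity) hk).mul_left C).of_nonneg_of_le
      (fun _ => by positivity) fun i => h _
  obtain ⟨S, κ, C, F₀, hκ, hC, ⟨i, hi⟩, hlim, hF⟩ := exists_finEntropy_limit
    (τ := 1 / T) (by positivity) hβ0 (hq.one_le_length hU.1) hk hs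
  obtain ⟨E, bound, hb, hE, hF₀, hreal, hrat, hbound⟩ :=
    hq.exists_recursive_stages hU.1.partrec F₀
  obtain ⟨G, hG, hGe⟩ := (isCompReal_finEntropy (l := fun k => (q k).length) hT0 hT hreal
    fun s => hF₀ s hi).exists_approx Computable.id
  have hpow : Tendsto (fun s : ℕ => (1 / 2 : ℝ) ^ s) atTop (𝓝 0) :=
    tendsto_pow_atTop_nhds_zero_of_lt_one (by norm_num) (by norm_num)
  have hGlim : Tendsto (fun s => (G s : ℝ) - (1 / 2) ^ s) atTop (𝓝 S) := by
    simpa using ((squeeze_zero_norm hGe hpow).add (hlim.comp hE)).sub hpow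
  refine ⟨S, ?_, ?_, ?_, ?_⟩
  · simp only [entropyFn_eq_finEntropy]
    -- The limit is taken along all finite sets, so the given enumeration and the recursive stages
    -- share it.
    exact hlim.comp tendsto_finset_range
  · exact isLeftComputable_of_approx hG hGe (fun s => (hF _ (hF₀ s)).1) hGlim
  · exact isChaitinRandom_of_approx hU hq hT0 hκ hG hGe hGlim hb hbound
      fun s => (hF _ (hF₀ s)).2.1
  · exact isCompressible_of_forall hT1 fun T' hTT' hT' =>
      exists_complexity_le_of_approx hU hq hT0 hTT' hT' hC hG hGe hE
        (hrat _ ((IsCompRat.const _).pow Computable.id)) (fun s => (hF _ (hF₀ s)).1)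
        fun s => (hF _ (hF₀ s)).2.2

theorem theorem4p4 (U : List Bool →. List Bool) (hU : IsOptimal U)
    (q : ℕ → List Bool) (hq : IsEnumeration q U) (T : ℝ) :
    (0 < T → T < 1 → IsComputableReal T →
      ∃ S : ℝ, Tendsto (fun n => entropyFn q n T) atTop (𝓝 S) ∧
        IsLeftComputable S ∧
        IsChaitinRandom U T (binaryExpansion S) ∧
        IsCompressible U T (binaryExpansion S)) ∧
    (1 ≤ T → Tendsto (fun n => entropyFn q n T) atTop atTop) :=
  ⟨fun hT0 hT1 hT => entropyFn_low_temperature hU hq hT0 hT1 hT,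
    fun hT => tendsto_entropyFn_atTop hU hq hT⟩
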